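/- Let $G$ be a finite simple graph that is a triangulation, i.e. a maximal planar graph: $G$ is planar, and adding an edge between any two distinct nonadjacent vertices of $G$ gives a graph that is not planar. Suppose that $G$ has $n \le 13$ vertices and maximum degree $\Delta(G) = n-4$. Let $\gamma_c(G)$ denote the connected domination number of $G$, i.e. the smallest number of vertices in a set $S \subseteq V(G)$ such that every vertex of $G$ is in $S$ or adjacent to a vertex in $S$, and the subgraph of $G$ induced by $S$ is connected. Then $\gamma_c(G) = 2$ or $\gamma_c(G) = 3$. -/

import Mathlib

namespace SimpleGraph

variable {V : Type*}

/-- A rotation system of a graph (a combinatorial embedding of it into an oriented surface):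
a permutation `next` of the darts (oriented edges) which, for every vertex `x`, permutes the
darts starting at `x` in a single cycle, the order in which they leave `x` in the drawing. -/
structure RotationSystem (G : SimpleGraph V) where
  next : Equiv.Perm G.Dart
  fst_next : ∀ d : G.Dart, (next d).fst = d.fst
  sameCycle : ∀ d e : G.Dart, d.fst = e.fst → next.SameCycle d e

/-- The reversal of darts, as a permutation. -/
def dartSymm (G : SimpleGraph V) : Equiv.Perm G.Dart where
  toFun d := d.symm
  invFun d := d.symm
  left_inv d := d.symm_symm
  right_inv d := d.symm_symm

namespace RotationSystem

variable {G : SimpleGraph V}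

/-- Face tracing: traverse the dart `d`, then leave its end point along the dart that follows
the reversed dart in the rotation there. -/
def facePerm (R : RotationSystem G) : Equiv.Perm G.Dart :=
  R.next * G.dartSymm

/-- The face boundary walks of a rotation system: the cycles of `facePerm`, fixed points
included. -/
def Face (R : RotationSystem G) : Type _ :=
  Quotient (Equiv.Perm.SameCycle.setoid R.facePerm)

/-- The number of faces, each connected component being drawn on a sphere of its own. An isolated
vertex has no darts; the sphere it is drawn on has exactly one face. -/
noncomputable def numFaces (R : RotationSystem G) : ℕ :=
  Nat.card R.Face + Nat.card {x : V // ∀ y, ¬ G.Adj x y}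

end RotationSystem

/-- A finite graph is planar if it has a crossing-free drawing on the sphere, given
combinatorially: it has a rotation system of genus zero, i.e. one with `V - E + F = 2 C`, where
`C` is the number of connected components. (For each single component, `V - E + F` is `2 - 2 g`
with `g ≥ 0` the genus of the surface, so that the equation says that all genera are zero.) -/
def IsPlanar (G : SimpleGraph V) : Prop :=
  ∃ R : RotationSystem G,
    Nat.card V + R.numFaces = Nat.card G.edgeSet + 2 * Nat.card G.ConnectedComponent

/-- A triangulation is a maximal planar graph: it is planar, and adding any edge between two
distinct nonadjacent vertices yields a graph that is not planar. -/
def IsTriangulation (G : SimpleGraph V) : Prop :=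
  G.IsPlanar ∧ ∀ x y : V, x ≠ y → ¬ G.Adj x y → ¬ (G ⊔ edge x y).IsPlanar

/-- `S` is a dominating set: every vertex is in `S` or adjacent to a vertex in `S`. -/
def IsDominatingSet (G : SimpleGraph V) (S : Set V) : Prop :=
  ∀ x : V, x ∈ S ∨ ∃ y ∈ S, G.Adj x y

/-- `S` is a dominating set that induces a connected subgraph. -/
def IsConnectedDominatingSet (G : SimpleGraph V) (S : Set V) : Prop :=
  G.IsDominatingSet S ∧ (G.induce S).Connected

/-- The connected domination number: the smallest size of a connected dominating set
(and `0` if there is none). -/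
noncomputable def connectedDominationNumber (G : SimpleGraph V) : ℕ :=
  sInf {k : ℕ | ∃ S : Finset V, G.IsConnectedDominatingSet (S : Set V) ∧ S.card = k}

end SimpleGraph

/-! A single vertex dominates at most Δ + 1 = n - 3 vertices, so two are always needed. For the
upper bound, suppose no connected dominating set has at most three vertices, and let `v` have degree
n - 4 with non-neighbours `u 0`, `u 1`, `u 2`. If two of the `u i` shared a neighbour in N(v), then
`v`, that neighbour and a neighbour of the third would form a dominating star. Hence the sets N(`u
i`) are disjoint subsets of N(v). They have at least three elements each and deg v ≤ 9, so n = 13,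
every `u i` has degree 3, and N(v) splits into three colour classes, each a triangle around some `u
i` (`neighbors_of_no_dominating`, `degree_eq_of_disjoint_neighbors`).

A path in N(v) on three colours would dominate the graph (`not_rainbow`). Of the 22 faces, 9 contain
`v`, 9 contain some `u i`, and 4 lie within N(v). Those 4 are neither rainbow nor monochromatic, so
each has exactly one edge with ends of the same colour. Counting the sides of the 9 edges of the
colour triangles, 9 face a `u i`, 4 face an inner face, and so 5 face `v`. The cycle of neighbours
of `v` thus has only four colour changes, and this forces a vertex between two neighbours of the
other two colours (`exists_rainbow_of_four_changes`), a contradiction.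

The face structure is derived from the combinatorial definition of planarity by linear algebra. Face
boundaries and gradients are orthogonal spaces of antisymmetric functions on the darts, which gives
Euler's inequality. In genus zero they span everything, which serves as the Jordan curve theorem.
Inserting an edge multiplies the face permutation by transpositions. Maximality then yields
connectedness and triangular faces (`exists_isTriangular`). -/

namespace Equiv.Perm

/-! ### Counting the cycles of a permutation by the dimension of its invariant functions. -/

variable {D : Type*}

/-- The real functions that are constant on the cycles of a permutation. -/
def invariants (π : Perm D) : Submodule ℝ (D → ℝ) where
  carrier := {f | ∀ d, f (π d) = f d}
  add_mem' hf hg d := by simp [hf d, hg d]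
  zero_mem' _ := rfl
  smul_mem' c f hf d := by simp [hf d]

theorem apply_eq_of_sameCycle {π : Perm D} {f : D → ℝ} (hf : f ∈ invariants π) {a b : D}
    (h : π.SameCycle a b) : f a = f b := by
  obtain ⟨n, rfl⟩ := h
  have key : ∀ (n : ℕ) (d : D), f ((π ^ n) d) = f d := by
    intro n
    induction n with
    | zero => simp
    | succ k ih => intro d; rw [pow_succ, mul_apply, ih, hf d]
  rcases n with n | n
  · simp [key]
  · rw [zpow_negSucc]
    have := key (n + 1) ((π ^ (n + 1))⁻¹ a)
    rw [← mul_apply, mul_inv_cancel, one_apply] at this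
    exact this

/-- Invariant functions are functions on the set of cycles. -/
noncomputable def invariantsEquiv (π : Perm D) :
    invariants π ≃ₗ[ℝ] (Quotient (SameCycle.setoid π) → ℝ) where
  toFun f q := Quotient.lift (s := SameCycle.setoid π) f.1
    (fun _ _ h => apply_eq_of_sameCycle f.2 h) q
  map_add' f g := by
    ext q; induction q using Quotient.inductionOn; rfl
  map_smul' c f := by
    ext q; induction q using Quotient.inductionOn; rfl
  invFun g := ⟨fun d => g (Quotient.mk (SameCycle.setoid π) d), fun d => by
    refine congrArg g ?_
    exact Quotient.sound (s := SameCycle.setoid π)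
      (show π.SameCycle (π d) d from (sameCycle_apply_left).2 (SameCycle.refl π d))⟩
  left_inv f := rfl
  right_inv g := by
    ext q; induction q using Quotient.inductionOn; rfl

theorem finrank_invariants [Finite D] (π : Perm D) :
    Module.finrank ℝ (invariants π) = Nat.card (Quotient (SameCycle.setoid π)) := by
  classical
  have := Fintype.ofFinite (Quotient (SameCycle.setoid π))
  rw [(invariantsEquiv π).finrank_eq, Module.finrank_fintype_fun_eq_card, Nat.card_eq_fintype_card]

/-- Invariant functions that agree at `a` and `b` survive the transposition, and this agreement is a
single linear condition. -/
theorem finrank_invariants_le_mul_swap [Finite D] [DecidableEq D] (π : Perm D) (a b : D) :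
    Module.finrank ℝ (invariants π) ≤ Module.finrank ℝ (invariants (π * swap a b)) + 1 := by
  let ev : invariants π →ₗ[ℝ] ℝ :=
    ((LinearMap.proj a : (D → ℝ) →ₗ[ℝ] ℝ) - LinearMap.proj b) ∘ₗ (invariants π).subtype
  have h1 := LinearMap.finrank_range_add_finrank_ker ev
  have h2 : Module.finrank ℝ (LinearMap.range ev) ≤ 1 := by
    simpa using Submodule.finrank_le (LinearMap.range ev)
  have h3 : (LinearMap.ker ev).map (invariants π).subtype ≤ invariants (π * swap a b) := by
    rintro _ ⟨f, hf, rfl⟩ d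
    have hab : f.1 a = f.1 b := by
      have : f.1 a - f.1 b = 0 := hf
      linarith
    simp only [Submodule.subtype_apply, mul_apply]
    rw [f.2]
    by_cases ha : d = a
    · subst ha; rw [swap_apply_left, hab]
    by_cases hb : d = b
    · subst hb; rw [swap_apply_right, hab]
    rw [swap_apply_of_ne_of_ne ha hb]
  have h4 := Submodule.finrank_mono h3
  rw [LinearEquiv.finrank_eq ((LinearMap.ker ev).equivMapOfInjective _
    (invariants π).injective_subtype).symm] at h4
  omega

/-- With `k` least such that `(π ^ k) a = b`, the new permutation sends `b` to `π a` and then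
follows `π` back to `b`, so the orbit of `b` is the segment from `π a` to `(π ^ k) a`, which avoids
`a`. -/
theorem not_sameCycle_mul_swap [Finite D] [DecidableEq D] {π : Perm D} {a b : D}
    (hab : a ≠ b) (h : π.SameCycle a b) : ¬ (π * swap a b).SameCycle b a := by
  intro hc
  obtain ⟨m, hm⟩ := h.exists_nat_pow_eq
  obtain ⟨n, hn⟩ := hc.exists_nat_pow_eq
  have hex : ∃ k, (π ^ k) a = b := ⟨m, hm⟩
  classical
  let k := Nat.find hex
  have hk : (π ^ k) a = b := Nat.find_spec hex
  have hmin : ∀ j < k, (π ^ j) a ≠ b := fun j hj => Nat.find_min hex hj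
  have hT : ∀ i, 0 < i → i ≤ k → (π ^ i) a ≠ a := by
    intro i hi hik hia
    apply hmin (k - i) (by omega)
    rw [← hk]
    nth_rewrite 2 [show k = (k - i) + i by omega]
    rw [pow_add, mul_apply, hia]
  have hk0 : 0 < k := by
    rcases Nat.eq_zero_or_pos k with h0 | h0
    · rw [h0] at hk; exact absurd hk hab
    · exact h0
  have key : ∀ n : ℕ, ∃ i, 0 < i ∧ i ≤ k ∧ (((π * swap a b) ^ n) b) = (π ^ i) a := by
    intro n
    induction n with
    | zero => exact ⟨k, hk0, le_rfl, by simp [hk]⟩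
    | succ n ih =>
      obtain ⟨i, hi, hik, he⟩ := ih
      rw [pow_succ', mul_apply, he, mul_apply]
      rcases hik.eq_or_lt with rfl | hlt
      · exact ⟨1, one_pos, hk0, by rw [hk, swap_apply_right, pow_one]⟩
      · refine ⟨i + 1, by omega, hlt, ?_⟩
        rw [swap_apply_of_ne_of_ne (hT i hi hik) (hmin i hlt), pow_succ', mul_apply]
  obtain ⟨i, hi, hik, he⟩ := key n
  exact hT i hi hik (he.symm.trans hn)

/-- All old invariants survive because they agree at `a` and `b`; the indicator of the new cycle of
`b` is an additional one, since it separates the two points. -/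
theorem finrank_invariants_lt_mul_swap [Finite D] [DecidableEq D] {π : Perm D} {a b : D}
    (hab : a ≠ b) (h : π.SameCycle a b) :
    Module.finrank ℝ (invariants π) < Module.finrank ℝ (invariants (π * swap a b)) := by
  classical
  apply Submodule.finrank_lt_finrank_of_lt
  refine lt_of_le_of_ne ?_ ?_
  · intro f hf d
    rw [mul_apply, hf]
    have := apply_eq_of_sameCycle hf h
    by_cases ha : d = a
    · subst ha; rw [swap_apply_left, this]
    by_cases hb : d = b
    · subst hb; rw [swap_apply_right, this]
    rw [swap_apply_of_ne_of_ne ha hb]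
  · intro he
    have hf : (fun d => if (π * swap a b).SameCycle b d then (1 : ℝ) else 0) ∈
        invariants (π * swap a b) := fun d => by
      simp only [sameCycle_apply_right]
    rw [← he] at hf
    have := apply_eq_of_sameCycle hf h
    simp [not_sameCycle_mul_swap hab h, SameCycle.refl] at this

theorem sameCycle_of_forall_invariants {π : Perm D} {a b : D}
    (h : ∀ f ∈ invariants π, f a = f b) : π.SameCycle a b := by
  classical
  have := h (fun d => if π.SameCycle a d then (1 : ℝ) else 0) fun d => by
    simp only [sameCycle_apply_right]
  by_contra hc
  simp [hc, SameCycle.refl] at this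

/-- The extended permutation fixes everything outside the range, so the values at `a` and `b` can be
prescribed freely. -/
theorem finrank_invariants_viaEmbedding {D' : Type*} [Finite D'] (π : Perm D) (ι : D ↪ D')
    {a b : D'} (ha : a ∉ Set.range ι) (hb : b ∉ Set.range ι) (hab : a ≠ b) :
    Module.finrank ℝ (invariants π) + 2 ≤
      Module.finrank ℝ (invariants (π.viaEmbedding ι)) := by
  classical
  have : Finite D := Finite.of_injective ι ι.injective
  let L : invariants (π.viaEmbedding ι) →ₗ[ℝ] invariants π × (ℝ × ℝ) :=
    { toFun := fun f => (⟨fun d => f.1 (ι d), fun d => by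
          beta_reduce; rw [← viaEmbedding_apply, f.2]⟩, (f.1 a, f.1 b))
      map_add' := fun f g => rfl
      map_smul' := fun c f => rfl }
  have hL : Function.Surjective L := by
    rintro ⟨f, r, s⟩
    have hι : ∀ d, (if h : ∃ c, ι c = ι d then f.1 h.choose else if ι d = a then r else s) =
        f.1 d := by
      intro d
      have h : ∃ c, ι c = ι d := ⟨d, rfl⟩
      rw [dif_pos h]
      exact congrArg f.1 (ι.injective h.choose_spec)
    refine ⟨⟨fun d => if h : ∃ c, ι c = d then f.1 h.choose else if d = a then r else s, ?_⟩, ?_⟩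
    · intro d
      by_cases hd : d ∈ Set.range ι
      · obtain ⟨c, rfl⟩ := hd
        beta_reduce
        rw [viaEmbedding_apply, hι, hι, f.2]
      · rw [viaEmbedding_apply_of_notMem _ _ _ hd]
    · have ha' : ¬ ∃ c, ι c = a := ha
      have hb' : ¬ ∃ c, ι c = b := hb
      refine Prod.ext (Subtype.ext (funext hι)) (Prod.ext ?_ ?_)
      · simp only [L, LinearMap.coe_mk, AddHom.coe_mk, dif_neg ha', if_true]
      · simp only [L, LinearMap.coe_mk, AddHom.coe_mk, dif_neg hb', if_neg hab.symm]
  have := LinearMap.finrank_le_finrank_of_surjective hL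
  simpa using this

end Equiv.Perm

/-! ### Gradients, face boundaries and Euler's inequality. -/

namespace SimpleGraph

variable {V : Type*} {G : SimpleGraph V}

instance [Finite V] : Finite G.Dart := Finite.of_injective _ Dart.toProd_injective

/-- The difference of a function on the vertices along the darts. -/
def gradient (G : SimpleGraph V) : (V → ℝ) →ₗ[ℝ] (G.Dart → ℝ) where
  toFun h d := h d.snd - h d.fst
  map_add' f g := by ext d; simp; ring
  map_smul' c f := by ext d; simp; ring

/-- The functions on darts that change sign when a dart is reversed. -/
def antisymmetric (G : SimpleGraph V) : Submodule ℝ (G.Dart → ℝ) where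
  carrier := {g | ∀ d, g d.symm = - g d}
  add_mem' hf hg d := by simp [hf d, hg d]; ring
  zero_mem' _ := by simp
  smul_mem' c f hf d := by simp [hf d]

theorem exists_dart_edge_eq (e : G.edgeSet) : ∃ d : G.Dart, d.edge = e := by
  obtain ⟨e, he⟩ := e
  induction e using Sym2.ind with
  | _ x y => exact ⟨⟨(x, y), he⟩, rfl⟩

theorem finrank_antisymmetric_le [Finite V] :
    Module.finrank ℝ G.antisymmetric ≤ Nat.card G.edgeSet := by
  classical
  have := Fintype.ofFinite V
  choose o ho using exists_dart_edge_eq (G := G)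
  let L : G.antisymmetric →ₗ[ℝ] (G.edgeSet → ℝ) :=
    { toFun := fun g e => g.1 (o e)
      map_add' := fun _ _ => rfl
      map_smul' := fun _ _ => rfl }
  have hL : Function.Injective L := by
    rw [← LinearMap.ker_eq_bot, LinearMap.ker_eq_bot']
    intro g hg
    ext d
    have h0 : g.1 (o ⟨d.edge, d.edge_mem⟩) = 0 := congrFun hg ⟨d.edge, d.edge_mem⟩
    rcases (dart_edge_eq_iff _ _).1 (ho ⟨d.edge, d.edge_mem⟩) with h | h
    · rw [h] at h0; exact h0
    · rw [h, g.2] at h0; simpa using h0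
  have := LinearMap.finrank_le_finrank_of_injective hL
  rwa [Module.finrank_fintype_fun_eq_card, ← Nat.card_eq_fintype_card] at this

theorem apply_eq_of_reachable {h : V → ℝ} (hh : G.gradient h = 0) {x y : V}
    (hxy : G.Reachable x y) : h x = h y := by
  obtain ⟨w⟩ := hxy
  induction w with
  | nil => rfl
  | @cons u v w a p ih =>
    rw [← ih]
    have : h v - h u = 0 := congrFun hh ⟨(u, v), a⟩
    linarith

/-- A function with zero gradient is a function on the set of connected components. -/
noncomputable def kerGradientEquiv (G : SimpleGraph V) :
    LinearMap.ker G.gradient ≃ₗ[ℝ] (G.ConnectedComponent → ℝ) where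
  toFun h c := Quot.lift h.1 (fun _ _ hr => apply_eq_of_reachable h.2 hr) c
  map_add' f g := by
    ext c; induction c using Quot.inductionOn; rfl
  map_smul' r f := by
    ext c; induction c using Quot.inductionOn; rfl
  invFun g := ⟨fun x => g (G.connectedComponentMk x), by
    ext d
    simp [gradient, ConnectedComponent.sound d.adj.reachable]⟩
  left_inv f := rfl
  right_inv g := by
    ext c; induction c using Quot.inductionOn; rfl

theorem finrank_range_gradient [Finite V] :
    Module.finrank ℝ (LinearMap.range G.gradient) + Nat.card G.ConnectedComponent =
      Nat.card V := by
  classical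
  have := Fintype.ofFinite V
  have h := LinearMap.finrank_range_add_finrank_ker G.gradient
  rw [G.kerGradientEquiv.finrank_eq, Module.finrank_fintype_fun_eq_card,
    Module.finrank_fintype_fun_eq_card] at h
  simpa only [Nat.card_eq_fintype_card] using h

namespace RotationSystem

open Equiv.Perm

theorem facePerm_apply (R : RotationSystem G) (d : G.Dart) :
    R.facePerm d = R.next d.symm := rfl

theorem fst_facePerm (R : RotationSystem G) (d : G.Dart) : (R.facePerm d).fst = d.snd :=
  R.fst_next d.symm

/-- The sum of the boundaries of the faces, weighted by a function on the faces. -/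
def boundary (R : RotationSystem G) : invariants R.facePerm →ₗ[ℝ] (G.Dart → ℝ) where
  toFun f d := f.1 d - f.1 d.symm
  map_add' f g := by ext d; simp; ring
  map_smul' c f := by ext d; simp; ring

/-- A face function with zero boundary agrees on each dart and its reverse, hence is invariant under
`next`. It is then a function of the starting vertex with zero gradient, so the kernel has dimension
at most the number of components. An isolated vertex contributes a free coordinate for its own face.
-/
theorem numFaces_le [Finite V] (R : RotationSystem G) :
    R.numFaces ≤ Module.finrank ℝ (LinearMap.range R.boundary) + Nat.card G.ConnectedComponent := by
  classical
  have := Fintype.ofFinite V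
  let B : (invariants R.facePerm × ({x : V // ∀ y, ¬ G.Adj x y} → ℝ)) →ₗ[ℝ] (G.Dart → ℝ) :=
    R.boundary ∘ₗ LinearMap.fst ℝ _ _
  have hB := LinearMap.finrank_range_add_finrank_ker B
  have hr : LinearMap.range B = LinearMap.range R.boundary :=
    LinearMap.range_comp_of_range_eq_top _ (LinearMap.range_eq_top.2 Prod.fst_surjective)
  have hd : Module.finrank ℝ (invariants R.facePerm × ({x : V // ∀ y, ¬ G.Adj x y} → ℝ)) =
      R.numFaces := by
    rw [Module.finrank_prod, finrank_invariants, Module.finrank_fintype_fun_eq_card,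
      ← Nat.card_eq_fintype_card]
    rfl
  rw [hr, hd] at hB
  have hiso : ∀ x : V, (¬ ∃ d : G.Dart, d.fst = x) → ∀ y, ¬ G.Adj x y :=
    fun x hx y hxy => hx ⟨⟨(x, y), hxy⟩, rfl⟩
  let L : (invariants R.facePerm × ({x : V // ∀ y, ¬ G.Adj x y} → ℝ)) →ₗ[ℝ] (V → ℝ) :=
    { toFun := fun f x => if hx : ∃ d : G.Dart, d.fst = x then f.1.1 hx.choose
        else f.2 ⟨x, hiso x hx⟩
      map_add' := fun f g => by
        ext x; by_cases hx : ∃ d : G.Dart, d.fst = x <;> simp [hx]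
      map_smul' := fun c f => by
        ext x; by_cases hx : ∃ d : G.Dart, d.fst = x <;> simp [hx] }
  have hval : ∀ f ∈ LinearMap.ker B, ∀ d : G.Dart, L f d.fst = f.1.1 d := by
    intro f hf d
    have hx : ∃ d' : G.Dart, d'.fst = d.fst := ⟨d, rfl⟩
    simp only [L, LinearMap.coe_mk, AddHom.coe_mk, dif_pos hx]
    have hnext : f.1.1 ∈ invariants R.next := by
      intro c
      have h1 : f.1.1 c - f.1.1 c.symm = 0 := congrFun hf c
      have h2 := f.1.2 c.symm
      rw [facePerm_apply, Dart.symm_symm] at h2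
      linarith
    exact apply_eq_of_sameCycle hnext (R.sameCycle _ _ hx.choose_spec)
  let L' : LinearMap.ker B →ₗ[ℝ] LinearMap.ker G.gradient :=
    (L.domRestrict (LinearMap.ker B)).codRestrict _ (fun ⟨f, hf⟩ => by
      ext d
      have h1 : f.1.1 d - f.1.1 d.symm = 0 := congrFun hf d
      have h2 := hval f hf d
      have h3 := hval f hf d.symm
      change L f d.snd - L f d.fst = 0
      change L f d.snd = _ at h3
      linarith)
  have hL0 : ∀ f ∈ LinearMap.ker B, L f = 0 → f = 0 := by
    intro f hf h0
    ext x
    · change f.1.1 x = 0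
      rw [← hval f hf, h0]; rfl
    · have hx : ¬ ∃ d : G.Dart, d.fst = x.1 := by
        rintro ⟨d, hd⟩
        exact x.2 d.snd (hd ▸ d.adj)
      have := congrFun h0 x.1
      simp only [L, LinearMap.coe_mk, AddHom.coe_mk, dif_neg hx] at this
      exact this
  have hL' : Function.Injective L' := by
    intro f₁ f₂ h
    have h' : L f₁.1 = L f₂.1 := congrArg Subtype.val h
    refine Subtype.ext (sub_eq_zero.1 (hL0 _ ((LinearMap.ker B).sub_mem f₁.2 f₂.2) ?_))
    rw [map_sub, h', sub_self]
  have h5 := LinearMap.finrank_le_finrank_of_injective hL'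
  rw [G.kerGradientEquiv.finrank_eq, Module.finrank_fintype_fun_eq_card,
    ← Nat.card_eq_fintype_card] at h5
  omega

/-- A face boundary is a closed walk, along which the differences of `h` telescope. -/
theorem sum_boundary_mul_gradient [Fintype G.Dart] (R : RotationSystem G)
    (f : invariants R.facePerm) (h : V → ℝ) :
    ∑ d, R.boundary f d * G.gradient h d = 0 := by
  have h1 : ∑ d : G.Dart, f.1 d.symm * (h d.snd - h d.fst) =
      ∑ d : G.Dart, f.1 d * (h d.fst - h d.snd) :=
    Equiv.sum_comp G.dartSymm (fun d : G.Dart => f.1 d * (h d.fst - h d.snd))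
  have h2 : ∑ d : G.Dart, f.1 d * h d.snd = ∑ d : G.Dart, f.1 d * h d.fst := by
    rw [← Equiv.sum_comp R.facePerm (fun d : G.Dart => f.1 d * h d.fst)]
    refine Finset.sum_congr rfl fun d _ => ?_
    rw [f.2 d, R.fst_facePerm]
  calc ∑ d, R.boundary f d * G.gradient h d
      = ∑ d : G.Dart, f.1 d * (h d.snd - h d.fst)
        - ∑ d : G.Dart, f.1 d.symm * (h d.snd - h d.fst) := by
        rw [← Finset.sum_sub_distrib]
        exact Finset.sum_congr rfl fun d _ => sub_mul _ _ _
    _ = 0 := by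
        rw [h1]
        simp only [mul_sub, Finset.sum_sub_distrib, h2]
        ring

theorem range_boundary_le (R : RotationSystem G) :
    LinearMap.range R.boundary ≤ G.antisymmetric := by
  rintro _ ⟨f, rfl⟩ d
  simp [boundary]

theorem range_gradient_le : LinearMap.range G.gradient ≤ G.antisymmetric := by
  rintro _ ⟨f, rfl⟩ d
  simp [gradient, Dart.symm]

theorem disjoint_range_boundary_range_gradient [Finite V] (R : RotationSystem G) :
    Disjoint (LinearMap.range R.boundary) (LinearMap.range G.gradient) := by
  classical
  have := Fintype.ofFinite V
  rw [Submodule.disjoint_def]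
  rintro _ ⟨f, rfl⟩ ⟨h, hh⟩
  have := R.sum_boundary_mul_gradient f h
  rw [hh] at this
  ext d
  simpa using (Finset.sum_eq_zero_iff_of_nonneg (fun d _ => mul_self_nonneg _)).1 this d
    (Finset.mem_univ d)

/-- The Euler characteristic of a rotation system is at most that of a union of spheres. -/
theorem card_add_numFaces_le [Finite V] (R : RotationSystem G) :
    Nat.card V + R.numFaces ≤ Nat.card G.edgeSet + 2 * Nat.card G.ConnectedComponent := by
  have h1 := R.numFaces_le
  have h2 := finrank_range_gradient (G := G)
  have h3 := Submodule.finrank_add_finrank_le_of_disjoint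
    (R.disjoint_range_boundary_range_gradient)
  have h4 := Submodule.finrank_mono (sup_le R.range_boundary_le (range_gradient_le (G := G)))
  have h5 := finrank_antisymmetric_le (G := G)
  have h6 := Submodule.finrank_sup_add_finrank_inf_eq (LinearMap.range R.boundary)
    (LinearMap.range G.gradient)
  rw [R.disjoint_range_boundary_range_gradient.eq_bot, finrank_bot] at h6
  omega

/-- In genus zero every circulation is a combination of face boundaries. -/
theorem exists_boundary_eq [Finite V] [Fintype G.Dart] (R : RotationSystem G)
    (hR : Nat.card V + R.numFaces = Nat.card G.edgeSet + 2 * Nat.card G.ConnectedComponent)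
    {g : G.Dart → ℝ} (hg : ∀ d : G.Dart, g d.symm = - g d)
    (hcirc : ∀ h : V → ℝ, ∑ d, g d * G.gradient h d = 0) :
    ∃ f ∈ invariants R.facePerm, ∀ d : G.Dart, f d - f d.symm = g d := by
  have h1 := R.numFaces_le
  have h2 := finrank_range_gradient (G := G)
  have h4 := sup_le R.range_boundary_le (range_gradient_le (G := G))
  have h5 := finrank_antisymmetric_le (G := G)
  have h6 := Submodule.finrank_sup_add_finrank_inf_eq (LinearMap.range R.boundary)
    (LinearMap.range G.gradient)
  rw [R.disjoint_range_boundary_range_gradient.eq_bot, finrank_bot] at h6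
  -- Genus zero makes the dimension count tight: boundaries and gradients together fill the
  -- antisymmetric functions. The gradient part of a circulation is then orthogonal to itself, hence
  -- zero.
  have h7 := Submodule.eq_of_le_of_finrank_le h4 (by omega)
  have hg' : g ∈ G.antisymmetric := hg
  rw [← h7, Submodule.mem_sup] at hg'
  obtain ⟨_, ⟨f, rfl⟩, _, ⟨h, rfl⟩, hfh⟩ := hg'
  have h8 := hcirc h
  have h9 := R.sum_boundary_mul_gradient f h
  have h10 : ∑ d, G.gradient h d * G.gradient h d = 0 := by
    rw [← h8, ← zero_add (∑ d, G.gradient h d * G.gradient h d), ← h9, ← Finset.sum_add_distrib]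
    refine Finset.sum_congr rfl fun d _ => ?_
    rw [← hfh, Pi.add_apply]; ring
  have h11 : G.gradient h = 0 := by
    ext d
    simpa using (Finset.sum_eq_zero_iff_of_nonneg (fun d _ => mul_self_nonneg _)).1 h10 d
      (Finset.mem_univ d)
  refine ⟨f.1, f.2, fun d => ?_⟩
  rw [← hfh, h11, add_zero]; rfl

end RotationSystem

end SimpleGraph

/-! ### Inserting an edge into a rotation system. -/

namespace Equiv.Perm

variable {D : Type*} [DecidableEq D]

/-- Multiplying by the transpositions inserts the fixed points `e` and `e'` into the cycles of `a`
and `b`, so questions about the new cycles reduce to the old ones. -/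
theorem invariants_mul_swap_mul_swap {π : Perm D} {a b e e' : D} (he : π e = e) (he' : π e' = e')
    (hab : a ≠ b) (hae' : a ≠ e') (hee' : e ≠ e') {f : D → ℝ}
    (hf : f ∈ invariants (π * swap a e * swap b e')) :
    f a = f e ∧ f b = f e' ∧ f ∈ invariants π := by
  have h1 : f a = f e := by
    have := hf a
    rw [mul_apply, mul_apply, swap_apply_of_ne_of_ne hab hae', swap_apply_left, he] at this
    exact this.symm
  have h2 : f b = f e' := by
    have := hf b
    rw [mul_apply, mul_apply, swap_apply_left, swap_apply_of_ne_of_ne hae'.symm hee'.symm,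
      he'] at this
    exact this.symm
  have hswap : ∀ u v : D, f u = f v → ∀ d, f (swap u v d) = f d := by
    intro u v huv d
    by_cases hu : d = u
    · subst hu; rw [swap_apply_left, huv]
    by_cases hv : d = v
    · subst hv; rw [swap_apply_right, huv]
    rw [swap_apply_of_ne_of_ne hu hv]
  refine ⟨h1, h2, fun d => ?_⟩
  have := hf (swap b e' (swap a e d))
  rw [mul_apply, mul_apply, swap_apply_self, swap_apply_self, hswap _ _ h2, hswap _ _ h1] at this
  exact this

theorem finrank_invariants_le_mul_swap_ite [Finite D] (π : Perm D) (a b : D) :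
    Module.finrank ℝ (invariants π) ≤
      Module.finrank ℝ (invariants (π * swap a b)) + (if a = b then 0 else 1) := by
  split_ifs with h
  · rw [h, swap_self]; exact le_of_eq rfl
  · exact finrank_invariants_le_mul_swap π a b

end Equiv.Perm

namespace SimpleGraph

open Equiv Equiv.Perm

variable {V : Type*} {G G' : SimpleGraph V}

/-- The darts of a subgraph as darts of the graph. -/
def dartEmbedding (h : G ≤ G') : G.Dart ↪ G'.Dart where
  toFun d := ⟨d.toProd, h d.adj⟩
  inj' _ _ hd := Dart.ext _ _ (Dart.mk.inj hd)

theorem notMem_range_dartEmbedding (h : G ≤ G') {e : G'.Dart} (he : ¬ G.Adj e.fst e.snd) :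
    e ∉ Set.range (dartEmbedding h) := by
  rintro ⟨d, rfl⟩
  exact he d.adj

theorem mem_range_dartEmbedding (h : G ≤ G') {e : G'.Dart} (he : G.Adj e.fst e.snd) :
    e ∈ Set.range (dartEmbedding h) :=
  ⟨⟨e.toProd, he⟩, rfl⟩

theorem dartSymm_eq_viaEmbedding_mul_swap [DecidableEq G'.Dart] (h : G ≤ G') {e : G'.Dart}
    (he : ¬ G.Adj e.fst e.snd) (hcov : ∀ d : G'.Dart, G.Adj d.fst d.snd ∨ d = e ∨ d = e.symm) :
    G'.dartSymm = G.dartSymm.viaEmbedding (dartEmbedding h) * swap e e.symm := by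
  have h1 := notMem_range_dartEmbedding h he
  have h2 := notMem_range_dartEmbedding h (e := e.symm) (fun hc => he hc.symm)
  ext1 d
  rw [mul_apply]
  rcases hcov d with hd | rfl | rfl
  · obtain ⟨c, rfl⟩ := mem_range_dartEmbedding h hd
    rw [swap_apply_of_ne_of_ne (fun hc => h1 ⟨c, hc⟩) (fun hc => h2 ⟨c, hc⟩), viaEmbedding_apply]
    rfl
  · rw [swap_apply_left, viaEmbedding_apply_of_notMem _ _ _ h2]; rfl
  · rw [swap_apply_right, viaEmbedding_apply_of_notMem _ _ _ h1]; exact e.symm_symm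

namespace RotationSystem

theorem fst_swap [DecidableEq G.Dart] {a e : G.Dart} (h : a.fst = e.fst) (d : G.Dart) :
    (swap a e d).fst = d.fst := by
  by_cases ha : d = a
  · subst ha; rw [swap_apply_left, h]
  by_cases he : d = e
  · subst he; rw [swap_apply_right, h]
  rw [swap_apply_of_ne_of_ne ha he]

theorem fst_viaEmbedding_next (R : RotationSystem G) (h : G ≤ G') (d : G'.Dart) :
    (R.next.viaEmbedding (dartEmbedding h) d).fst = d.fst := by
  by_cases hd : d ∈ Set.range (dartEmbedding h)
  · obtain ⟨c, rfl⟩ := hd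
    rw [viaEmbedding_apply]
    exact R.fst_next c
  · rw [viaEmbedding_apply_of_notMem _ _ _ hd]

section addEdge

variable [DecidableEq G'.Dart] (R : RotationSystem G) (h : G ≤ G') {e : G'.Dart}
  (he : ¬ G.Adj e.fst e.snd) (hcov : ∀ d : G'.Dart, G.Adj d.fst d.snd ∨ d = e ∨ d = e.symm)
  {a b : G'.Dart} (ha : a.fst = e.fst) (hb : b.fst = e.snd)
  (hae : a = e → ∀ z, ¬ G.Adj e.fst z) (hbe : b = e.symm → ∀ z, ¬ G.Adj e.snd z)

/-- The rotation system of a graph with one more edge, whose darts are inserted into the rotation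
after the darts `a` and `b`; an end that was isolated is left by the new dart only, which is
encoded by taking that dart itself as its predecessor. -/
noncomputable def addEdge : RotationSystem G' where
  next := R.next.viaEmbedding (dartEmbedding h) * swap a e * swap b e.symm
  fst_next d := by
    rw [mul_apply, mul_apply, fst_viaEmbedding_next, fst_swap ha, fst_swap (e := e.symm) hb]
  sameCycle d d' hdd' := by
    have h1 := notMem_range_dartEmbedding h he
    have h2 := notMem_range_dartEmbedding h (e := e.symm) (fun hc => he hc.symm)
    have hne := e.fst_ne_snd
    refine sameCycle_of_forall_invariants fun f hf => ?_
    obtain ⟨hfa, hfb, hfi⟩ := invariants_mul_swap_mul_swap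
      (viaEmbedding_apply_of_notMem _ _ _ h1) (viaEmbedding_apply_of_notMem _ _ _ h2)
      (by rintro rfl; exact hne (ha.symm.trans hb))
      (by rintro rfl; exact hne ha.symm)
      e.symm_ne.symm hf
    have hold : ∀ c c' : G.Dart, c.fst = c'.fst →
        f (dartEmbedding h c) = f (dartEmbedding h c') := by
      intro c c' hc
      have hi : (fun c => f (dartEmbedding h c)) ∈ invariants R.next := fun c => by
        beta_reduce
        rw [← viaEmbedding_apply, hfi]
      exact apply_eq_of_sameCycle hi (R.sameCycle c c' hc)
    have hx : ∀ d : G'.Dart, d.fst = e.fst → f d = f e := by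
      intro d hd
      rcases hcov d with hdG | rfl | rfl
      · rcases hcov a with haG | rfl | rfl
        · obtain ⟨c, rfl⟩ := mem_range_dartEmbedding h hdG
          obtain ⟨c', rfl⟩ := mem_range_dartEmbedding h haG
          rw [← hfa]
          exact hold c c' (hd.trans ha.symm)
        · exact absurd (hd ▸ hdG) (hae rfl _)
        · exact absurd ha.symm hne
      · rfl
      · exact absurd hd.symm hne
    have hy : ∀ d : G'.Dart, d.fst = e.snd → f d = f e.symm := by
      intro d hd
      rcases hcov d with hdG | rfl | rfl
      · rcases hcov b with hbG | rfl | rfl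
        · obtain ⟨c, rfl⟩ := mem_range_dartEmbedding h hdG
          obtain ⟨c', rfl⟩ := mem_range_dartEmbedding h hbG
          rw [← hfb]
          exact hold c c' (hd.trans hb.symm)
        · exact absurd hb hne
        · exact absurd (hd ▸ hdG) (hbe rfl _)
      · exact absurd hd hne
      · rfl
    rcases hcov d with hdG | rfl | rfl
    · rcases hcov d' with hdG' | rfl | rfl
      · obtain ⟨c, rfl⟩ := mem_range_dartEmbedding h hdG
        obtain ⟨c', rfl⟩ := mem_range_dartEmbedding h hdG'
        exact hold c c' hdd'
      · exact hx _ hdd'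
      · exact hy _ hdd'
    · exact (hx _ hdd'.symm).symm
    · exact (hy _ hdd'.symm).symm

/-- The new reversal is the old one times `swap e e.symm`. Moving the old reversal leftwards past
the two insertions conjugates them, replacing `a` and `b` by their reverses. -/
theorem facePerm_addEdge :
    (R.addEdge h he hcov ha hb hae hbe).facePerm =
      R.facePerm.viaEmbedding (dartEmbedding h) *
        swap (G.dartSymm.viaEmbedding (dartEmbedding h) a) e *
        swap (G.dartSymm.viaEmbedding (dartEmbedding h) b) e.symm * swap e e.symm := by
  have h1 := notMem_range_dartEmbedding h he
  have h2 := notMem_range_dartEmbedding h (e := e.symm) (fun hc => he hc.symm)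
  have hsymm : ∀ d, G.dartSymm.viaEmbedding (dartEmbedding h)
      (G.dartSymm.viaEmbedding (dartEmbedding h) d) = d := by
    intro d
    by_cases hd : d ∈ Set.range (dartEmbedding h)
    · obtain ⟨c, rfl⟩ := hd
      rw [viaEmbedding_apply, viaEmbedding_apply]
      exact congrArg _ c.symm_symm
    · rw [viaEmbedding_apply_of_notMem _ _ _ hd, viaEmbedding_apply_of_notMem _ _ _ hd]
  have hφ : R.facePerm.viaEmbedding (dartEmbedding h) =
      R.next.viaEmbedding (dartEmbedding h) * G.dartSymm.viaEmbedding (dartEmbedding h) :=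
    map_mul (viaEmbeddingHom (dartEmbedding h)) _ _
  have hs : ∀ u v, u ∉ Set.range (dartEmbedding h) →
      G.dartSymm.viaEmbedding (dartEmbedding h) *
        swap (G.dartSymm.viaEmbedding (dartEmbedding h) v) u =
      swap v u * G.dartSymm.viaEmbedding (dartEmbedding h) := by
    intro u v hu
    rw [mul_swap_eq_swap_mul, hsymm, viaEmbedding_apply_of_notMem _ _ _ hu]
  rw [facePerm, dartSymm_eq_viaEmbedding_mul_swap h he hcov, hφ]
  simp only [addEdge, mul_assoc]
  rw [← mul_assoc (G.dartSymm.viaEmbedding _) (swap _ e), hs _ _ h1, mul_assoc,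
    ← mul_assoc (G.dartSymm.viaEmbedding _) (swap _ e.symm), hs _ _ h2]
  simp only [mul_assoc]

end addEdge

theorem numFaces_eq [Finite V] (R : RotationSystem G) :
    R.numFaces = Module.finrank ℝ (invariants R.facePerm) +
      {x : V | ∀ y, ¬ G.Adj x y}.ncard := by
  rw [finrank_invariants]; rfl

theorem ncard_isolated_le [Finite V] [DecidableEq G'.Dart] {e : G'.Dart}
    (hcov : ∀ d : G'.Dart, G.Adj d.fst d.snd ∨ d = e ∨ d = e.symm) {a b : G'.Dart}
    (ha : a.fst = e.fst) (hb : b.fst = e.snd) :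
    {x : V | ∀ y, ¬ G.Adj x y}.ncard ≤ {x : V | ∀ y, ¬ G'.Adj x y}.ncard +
      (if a = e then 1 else 0) + (if b = e.symm then 1 else 0) := by
  classical
  have hsub : {x : V | ∀ y, ¬ G.Adj x y} ⊆ {x : V | ∀ y, ¬ G'.Adj x y} ∪
      (if a = e then {e.fst} else ∅) ∪ (if b = e.symm then {e.snd} else ∅) := by
    intro x hx
    by_cases hx' : ∀ y, ¬ G'.Adj x y
    · exact Or.inl (Or.inl hx')
    push Not at hx'
    obtain ⟨y, hy⟩ := hx'
    rcases hcov ⟨(x, y), hy⟩ with h1 | h1 | h1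
    · exact absurd h1 (hx y)
    · have hxe : x = e.fst := congrArg (fun d : G'.Dart => d.fst) h1
      have : a = e := by
        rcases hcov a with h2 | h2 | h2
        · exact absurd (by rw [hxe, ← ha]; exact h2) (hx a.snd)
        · exact h2
        · rw [h2] at ha; exact absurd ha.symm e.fst_ne_snd
      rw [if_pos this]
      exact Or.inl (Or.inr hxe)
    · have hxe : x = e.snd := congrArg (fun d : G'.Dart => d.fst) h1
      have : b = e.symm := by
        rcases hcov b with h2 | h2 | h2
        · exact absurd (by rw [hxe, ← hb]; exact h2) (hx b.snd)
        · rw [h2] at hb; exact absurd hb e.fst_ne_snd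
        · exact h2
      rw [if_pos this]
      exact Or.inr hxe
  refine (Set.ncard_le_ncard hsub (Set.toFinite _)).trans ?_
  refine (Set.ncard_union_le _ _).trans (add_le_add ((Set.ncard_union_le _ _).trans
    (add_le_add le_rfl ?_)) ?_) <;> split_ifs <;> simp

theorem viaEmbedding_dartSymm_eq_iff (h : G ≤ G') {u v : G'.Dart}
    (hu : u ∉ Set.range (dartEmbedding h)) :
    G.dartSymm.viaEmbedding (dartEmbedding h) v = u ↔ v = u := by
  nth_rewrite 1 [← viaEmbedding_apply_of_notMem G.dartSymm (dartEmbedding h) u hu]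
  exact (Equiv.injective _).eq_iff

section addEdge

variable [Finite V] [DecidableEq G'.Dart] (R : RotationSystem G) (h : G ≤ G') {e : G'.Dart}
  (he : ¬ G.Adj e.fst e.snd) (hcov : ∀ d : G'.Dart, G.Adj d.fst d.snd ∨ d = e ∨ d = e.symm)
  {a b : G'.Dart} (ha : a.fst = e.fst) (hb : b.fst = e.snd)
  (hae : a = e → ∀ z, ¬ G.Adj e.fst z) (hbe : b = e.symm → ∀ z, ¬ G.Adj e.snd z)

/-- The two new darts start as two extra cycles, and each of three transpositions merges at most two
cycles: a net loss of at most one. At an isolated end the transposition is trivial, which makes up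
for the face of that vertex. -/
theorem numFaces_le_addEdge :
    R.numFaces ≤ (R.addEdge h he hcov ha hb hae hbe).numFaces + 1 := by
  have h1 := notMem_range_dartEmbedding h he
  have h2 := notMem_range_dartEmbedding h (e := e.symm) (fun hc => he hc.symm)
  rw [numFaces_eq, numFaces_eq, facePerm_addEdge]
  have k1 := ncard_isolated_le hcov ha hb
  have k2 := finrank_invariants_viaEmbedding R.facePerm (dartEmbedding h) h1 h2 e.symm_ne.symm
  have k3 := finrank_invariants_le_mul_swap_ite (R.facePerm.viaEmbedding (dartEmbedding h))
    (G.dartSymm.viaEmbedding (dartEmbedding h) a) e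
  have k4 := finrank_invariants_le_mul_swap_ite (R.facePerm.viaEmbedding (dartEmbedding h) *
    swap (G.dartSymm.viaEmbedding (dartEmbedding h) a) e)
    (G.dartSymm.viaEmbedding (dartEmbedding h) b) e.symm
  have k5 := finrank_invariants_le_mul_swap (R.facePerm.viaEmbedding (dartEmbedding h) *
    swap (G.dartSymm.viaEmbedding (dartEmbedding h) a) e *
    swap (G.dartSymm.viaEmbedding (dartEmbedding h) b) e.symm) e e.symm
  simp only [viaEmbedding_dartSymm_eq_iff h h1, viaEmbedding_dartSymm_eq_iff h h2] at k3 k4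
  split_ifs at k1 k3 k4 <;> omega

end addEdge

/-- The first two transpositions cost at most the two new cycles and put `e` and `e.symm` on the
common face, so the third one splits that face. -/
theorem numFaces_lt_addEdge [Finite V] [DecidableEq G'.Dart] (R : RotationSystem G) (h : G ≤ G')
    {e : G'.Dart} (he : ¬ G.Adj e.fst e.snd)
    (hcov : ∀ d : G'.Dart, G.Adj d.fst d.snd ∨ d = e ∨ d = e.symm) {p q : G.Dart}
    (ha : (dartEmbedding h p).fst = e.fst) (hb : (dartEmbedding h q).fst = e.snd)
    (hae : dartEmbedding h p = e → ∀ z, ¬ G.Adj e.fst z)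
    (hbe : dartEmbedding h q = e.symm → ∀ z, ¬ G.Adj e.snd z)
    (hpq : R.facePerm.SameCycle p.symm q.symm) :
    R.numFaces < (R.addEdge h he hcov ha hb hae hbe).numFaces := by
  have h1 := notMem_range_dartEmbedding h he
  have h2 := notMem_range_dartEmbedding h (e := e.symm) (fun hc => he hc.symm)
  have hp : ∀ c, dartEmbedding h c ≠ e := fun c hc => h1 ⟨c, hc⟩
  have hq : ∀ c, dartEmbedding h c ≠ e.symm := fun c hc => h2 ⟨c, hc⟩
  have hpq' : dartEmbedding h p.symm ≠ dartEmbedding h q.symm := by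
    intro hc
    have := congrArg Dart.symm ((dartEmbedding h).injective hc)
    rw [Dart.symm_symm, Dart.symm_symm] at this
    subst this
    exact e.fst_ne_snd (ha.symm.trans hb)
  rw [numFaces_eq, numFaces_eq, facePerm_addEdge]
  have k1 := ncard_isolated_le hcov ha hb
  rw [if_neg (hp p), if_neg (hq q)] at k1
  have k2 := finrank_invariants_viaEmbedding R.facePerm (dartEmbedding h) h1 h2 e.symm_ne.symm
  have hsp : ∀ c, G.dartSymm.viaEmbedding (dartEmbedding h) (dartEmbedding h c) =
    dartEmbedding h c.symm := fun c => viaEmbedding_apply _ _ _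
  rw [hsp, hsp]
  have k3 := finrank_invariants_le_mul_swap (R.facePerm.viaEmbedding (dartEmbedding h))
    (dartEmbedding h p.symm) e
  have k4 := finrank_invariants_le_mul_swap (R.facePerm.viaEmbedding (dartEmbedding h) *
    swap (dartEmbedding h p.symm) e) (dartEmbedding h q.symm) e.symm
  have hcyc : (R.facePerm.viaEmbedding (dartEmbedding h) *
      swap (dartEmbedding h p.symm) e * swap (dartEmbedding h q.symm) e.symm).SameCycle
      e e.symm := by
    refine sameCycle_of_forall_invariants fun f hf => ?_
    obtain ⟨hfa, hfb, hfi⟩ := invariants_mul_swap_mul_swap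
      (viaEmbedding_apply_of_notMem _ _ _ h1) (viaEmbedding_apply_of_notMem _ _ _ h2)
      hpq' (hq _) e.symm_ne.symm hf
    rw [← hfa, ← hfb]
    have hi : (fun c => f (dartEmbedding h c)) ∈ invariants R.facePerm := fun c => by
      beta_reduce
      rw [← viaEmbedding_apply, hfi]
    exact apply_eq_of_sameCycle hi hpq
  have k5 := finrank_invariants_lt_mul_swap e.symm_ne.symm hcyc
  omega

end RotationSystem

theorem sup_edge_dart_cases {x y : V} (hxy : x ≠ y) (d : (G ⊔ edge x y).Dart) :
    G.Adj d.fst d.snd ∨ d = ⟨(x, y), Or.inr (by simp [edge_adj, hxy])⟩ ∨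
      d = Dart.symm ⟨(x, y), Or.inr (by simp [edge_adj, hxy])⟩ := by
  obtain ⟨⟨u, v⟩, hd⟩ := d
  have hd' : G.Adj u v ∨ (edge x y).Adj u v := hd
  rw [edge_adj] at hd'
  rcases hd' with h | ⟨⟨rfl, rfl⟩ | ⟨rfl, rfl⟩, -⟩
  · exact Or.inl h
  · exact Or.inr (Or.inl rfl)
  · exact Or.inr (Or.inr rfl)

/-! ### Edges that can be added to a planar graph. -/

section planarity

variable [Finite V] {x y : V}

theorem card_edgeSet_sup_edge (hn : ¬ G.Adj x y) (hxy : x ≠ y) :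
    Nat.card (G ⊔ edge x y).edgeSet = Nat.card G.edgeSet + 1 := by
  classical
  have := Fintype.ofFinite V
  have := G.card_edgeFinset_sup_edge hn hxy
  rwa [edgeFinset_card, edgeFinset_card, ← Nat.card_eq_fintype_card,
    ← Nat.card_eq_fintype_card] at this

theorem card_connectedComponent_lt (h : G ≤ G') (hxy : ¬ G.Reachable x y)
    (hxy' : G'.Reachable x y) :
    Nat.card G'.ConnectedComponent < Nat.card G.ConnectedComponent := by
  have hs := ConnectedComponent.surjective_map_ofLE h
  refine lt_of_le_of_ne (ConnectedComponent.card_le_card_of_le h) fun hc => ?_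
  have hb := (Nat.bijective_iff_surjective_and_card _).2 ⟨hs, hc.symm⟩
  exact hxy (ConnectedComponent.exact (hb.1 (ConnectedComponent.sound hxy')))

/-- One more edge, at least one component fewer and at most one face fewer: equality in Euler's
inequality persists. -/
theorem IsPlanar.sup_edge_of_not_reachable (hG : G.IsPlanar) (hxy : ¬ G.Reachable x y) :
    (G ⊔ edge x y).IsPlanar := by
  classical
  obtain ⟨R, hR⟩ := hG
  have hne : x ≠ y := by rintro rfl; exact hxy (Reachable.refl _)
  have hn : ¬ G.Adj x y := fun h => hxy h.reachable
  have h : G ≤ G ⊔ edge x y := le_sup_left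
  let e : (G ⊔ edge x y).Dart := ⟨(x, y), Or.inr (by simp [edge_adj, hne])⟩
  have hcov : ∀ d : (G ⊔ edge x y).Dart, G.Adj d.fst d.snd ∨ d = e ∨ d = e.symm :=
    sup_edge_dart_cases hne
  have key : ∀ c : (G ⊔ edge x y).Dart, ¬ G.Adj c.fst c.snd →
      ∃ a : (G ⊔ edge x y).Dart, a.fst = c.fst ∧ (a = c → ∀ z, ¬ G.Adj c.fst z) := by
    intro c hc
    by_cases hz : ∃ z, G.Adj c.fst z
    · obtain ⟨z, hz⟩ := hz
      refine ⟨⟨(c.fst, z), h hz⟩, rfl, fun hac => ?_⟩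
      rw [← hac] at hc
      exact absurd hz hc
    · exact ⟨c, rfl, fun _ z hz' => hz ⟨z, hz'⟩⟩
  obtain ⟨a, ha, hae⟩ := key e hn
  obtain ⟨b, hb, hbe⟩ := key e.symm (fun hc => hn hc.symm)
  have h1 := R.numFaces_le_addEdge h (e := e) hn hcov ha hb hae hbe
  have h2 := (R.addEdge h (e := e) hn hcov ha hb hae hbe).card_add_numFaces_le
  have h3 := card_edgeSet_sup_edge hn hne
  have h4 := card_connectedComponent_lt h hxy e.adj.reachable
  exact ⟨R.addEdge h (e := e) hn hcov ha hb hae hbe, by omega⟩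

/-- An edge joining two vertices on the boundary of a face can be drawn in that face. -/
theorem RotationSystem.isPlanar_sup_edge_of_sameCycle (R : RotationSystem G)
    (hR : Nat.card V + R.numFaces = Nat.card G.edgeSet + 2 * Nat.card G.ConnectedComponent)
    {c d : G.Dart} (hcd : R.facePerm.SameCycle c d) (hne : c.fst ≠ d.fst)
    (hn : ¬ G.Adj c.fst d.fst) : (G ⊔ edge c.fst d.fst).IsPlanar := by
  classical
  have h : G ≤ G ⊔ edge c.fst d.fst := le_sup_left
  let e : (G ⊔ edge c.fst d.fst).Dart := ⟨(c.fst, d.fst), Or.inr (by simp [edge_adj, hne])⟩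
  have hcov : ∀ d' : (G ⊔ edge c.fst d.fst).Dart, G.Adj d'.fst d'.snd ∨ d' = e ∨ d' = e.symm :=
    sup_edge_dart_cases hne
  have hinv : ∀ u : G.Dart, (R.facePerm.symm u).symm.fst = u.fst := by
    intro u
    have := R.fst_facePerm (R.facePerm.symm u)
    rw [apply_symm_apply] at this
    exact this.symm
  have hsc : R.facePerm.SameCycle (R.facePerm.symm c) (R.facePerm.symm d) := by
    rwa [← sameCycle_apply_left, ← sameCycle_apply_right, apply_symm_apply, apply_symm_apply]
  have h1 := notMem_range_dartEmbedding h (e := e) hn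
  have h2 := notMem_range_dartEmbedding h (e := e.symm) (fun hc => hn hc.symm)
  let p := (R.facePerm.symm c).symm
  let q := (R.facePerm.symm d).symm
  have ha : (dartEmbedding h p).fst = e.fst := hinv c
  have hb : (dartEmbedding h q).fst = e.snd := hinv d
  have hae : dartEmbedding h p = e → ∀ z, ¬ G.Adj e.fst z := fun hc => absurd ⟨_, hc⟩ h1
  have hbe : dartEmbedding h q = e.symm → ∀ z, ¬ G.Adj e.snd z := fun hc => absurd ⟨_, hc⟩ h2
  have h3 := R.numFaces_lt_addEdge h (e := e) hn hcov ha hb hae hbe (by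
    simp only [p, q, Dart.symm_symm]; exact hsc)
  have h4 := (R.addEdge h (e := e) hn hcov ha hb hae hbe).card_add_numFaces_le
  have h5 := card_edgeSet_sup_edge hn hne
  have h6 := ConnectedComponent.card_le_card_of_le h
  exact ⟨R.addEdge h (e := e) hn hcov ha hb hae hbe, by omega⟩

end planarity

end SimpleGraph

/-! ### Maximal planar graphs have triangular faces. -/

namespace Equiv.Perm

variable {D : Type*}

theorem card_eq_three_mul_card_quotient [Finite D] {π : Perm D} (h3 : ∀ d, π (π (π d)) = d)
    (h1 : ∀ d, π d ≠ d) : Nat.card D = 3 * Nat.card (Quotient (SameCycle.setoid π)) := by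
  classical
  have hpow : ∀ n : ℕ, ∀ d, (π ^ (3 * n)) d = d := by
    intro n
    induction n with
    | zero => simp
    | succ n ih =>
      intro d
      rw [mul_add, pow_add, mul_apply, mul_one]
      change (π ^ (3 * n)) (π (π (π d))) = d
      rw [h3, ih]
  let F : Quotient (SameCycle.setoid π) × Fin 3 → D := fun p => (π ^ (p.2 : ℕ)) p.1.out
  have hmk : ∀ p, Quotient.mk (SameCycle.setoid π) (F p) = p.1 := by
    intro p
    refine Eq.trans ?_ (Quotient.out_eq p.1)
    exact Quotient.sound (s := SameCycle.setoid π)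
      (show π.SameCycle _ _ from sameCycle_pow_left.2 (SameCycle.refl π _))
  have hF : Function.Bijective F := by
    constructor
    · rintro ⟨q, i⟩ ⟨q', j⟩ hij
      have hq : q = q' := (hmk (q, i)).symm.trans ((congrArg _ hij).trans (hmk (q', j)))
      subst hq
      have h01 := h1 q.out
      have h12 := h1 (π q.out)
      have h02 : π (π q.out) ≠ q.out := fun hc => h1 q.out (by
        have := h3 q.out
        rwa [hc] at this)
      have e0 : F (q, 0) = q.out := rfl
      have e1 : F (q, 1) = π q.out := rfl
      have e2 : F (q, 2) = π (π q.out) := rfl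
      fin_cases i <;> fin_cases j <;> first
        | rfl
        | (exfalso
           simp only [Fin.zero_eta, Fin.mk_one, Fin.reduceFinMk, e0, e1, e2] at hij
           first
             | exact h01 hij
             | exact h01 hij.symm
             | exact h12 hij
             | exact h12 hij.symm
             | exact h02 hij
             | exact h02 hij.symm)
    · intro d
      have hs : π.SameCycle (Quotient.mk (SameCycle.setoid π) d).out d :=
        Quotient.exact (s := SameCycle.setoid π) (Quotient.out_eq _)
      obtain ⟨n, hn⟩ := hs.exists_nat_pow_eq
      refine ⟨(Quotient.mk (SameCycle.setoid π) d, ⟨n % 3, Nat.mod_lt _ (by norm_num)⟩), ?_⟩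
      change (π ^ (n % 3)) _ = d
      rw [← Nat.mod_add_div n 3, pow_add, mul_apply, hpow] at hn
      exact hn
  rw [← Nat.card_eq_of_bijective F hF, Nat.card_prod, Nat.card_fin, mul_comm]

end Equiv.Perm

namespace SimpleGraph

open Equiv Equiv.Perm

variable {V : Type*} {G : SimpleGraph V}

theorem Connected.mem_of_forall_adj (hG : G.Connected) {S : Set V} {x : V} (hx : x ∈ S)
    (hS : ∀ u ∈ S, ∀ w, G.Adj u w → w ∈ S) (z : V) : z ∈ S := by
  obtain ⟨p⟩ := hG.preconnected x z
  induction p with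
  | nil => exact hx
  | cons h _ ih => exact ih (hS _ hx _ h)

theorem IsTriangulation.connected [Finite V] [Nonempty V] (hG : G.IsTriangulation) :
    G.Connected := by
  refine ⟨fun x y => ?_⟩
  by_contra hxy
  exact hG.2 x y (by rintro rfl; exact hxy (Reachable.refl _)) (fun h => hxy h.reachable)
    (hG.1.sup_edge_of_not_reachable hxy)

namespace RotationSystem

variable (R : RotationSystem G)

theorem eq_of_next_eq {d : G.Dart} (hd : R.next d = d) {d' : G.Dart} (h : d'.fst = d.fst) :
    d' = d :=
  ((R.sameCycle d d' h.symm).eq_of_left hd).symm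

/-- Otherwise `d.fst` is a leaf. If `d.snd` is a leaf too, the graph has two vertices; if not, the
face walk goes on to another neighbour of `d.snd`, which `hadj` makes adjacent to the leaf. -/
theorem next_ne [Finite V] (hconn : G.Connected) (hcard : 3 ≤ Nat.card V)
    (hadj : ∀ c d : G.Dart, R.facePerm.SameCycle c d → c.fst ≠ d.fst → G.Adj c.fst d.fst)
    (d : G.Dart) : R.next d ≠ d := by
  classical
  have := Fintype.ofFinite V
  intro hd
  have hnb : ∀ w, G.Adj d.fst w → w = d.snd := fun w hw =>
    congrArg (fun c : G.Dart => c.snd) (R.eq_of_next_eq hd (d' := ⟨(d.fst, w), hw⟩) rfl)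
  by_cases hd' : R.next d.symm = d.symm
  · have hnb' : ∀ w, G.Adj d.snd w → w = d.fst := fun w hw =>
      congrArg (fun c : G.Dart => c.snd) (R.eq_of_next_eq hd' (d' := ⟨(d.snd, w), hw⟩) rfl)
    have hall : ∀ z, z ∈ ({d.fst, d.snd} : Finset V) := fun z =>
      Finset.mem_coe.1 (hconn.mem_of_forall_adj (S := ({d.fst, d.snd} : Finset V)) (x := d.fst)
        (by simp) (fun u hu w huw => by
          simp only [Finset.coe_insert, Finset.coe_singleton, Set.mem_insert_iff,
            Set.mem_singleton_iff] at hu ⊢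
          rcases hu with rfl | rfl
          · exact Or.inr (hnb w huw)
          · exact Or.inl (hnb' w huw)) z)
    have h1 : (Finset.univ : Finset V).card ≤ ({d.fst, d.snd} : Finset V).card :=
      Finset.card_le_card fun z _ => hall z
    have h2 := Finset.card_le_two (a := d.fst) (b := d.snd)
    rw [Finset.card_univ, ← Nat.card_eq_fintype_card] at h1
    omega
  · have h1 : (R.facePerm (R.facePerm d)).fst = (R.next d.symm).snd := R.fst_facePerm _
    have h2 : (R.next d.symm).fst = d.snd := R.fst_next _
    have h3 : (R.next d.symm).snd ≠ d.fst := fun hc => hd' (Dart.ext _ _ (Prod.ext h2 hc))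
    have h4 := hadj d (R.facePerm (R.facePerm d))
      (sameCycle_apply_right.2 (sameCycle_apply_right.2 (SameCycle.refl _ _)))
      (by rw [h1]; exact h3.symm)
    rw [h1] at h4
    have h5 := (R.next d.symm).adj
    rw [hnb _ h4, h2] at h5
    exact h5.ne rfl

/-- A form of the Jordan curve theorem: two edges that join alternating vertices of a face,
drawn outside of it, would cross. -/
theorem not_adj_and_adj [Finite V]
    (hR : Nat.card V + R.numFaces = Nat.card G.edgeSet + 2 * Nat.card G.ConnectedComponent)
    {d : G.Dart} (h02 : G.Adj (R.facePerm d).snd d.fst)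
    (h13 : G.Adj d.snd (R.facePerm (R.facePerm d)).snd)
    (h30 : (R.facePerm (R.facePerm d)).snd ≠ d.fst) : False := by
  classical
  have := Fintype.ofFinite V
  set t₁ := R.facePerm d with ht₁
  set d₂ := R.facePerm t₁ with hd₂
  have e1 : t₁.fst = d.snd := R.fst_facePerm d
  have e2 : d₂.fst = t₁.snd := R.fst_facePerm t₁
  let t₂ : G.Dart := ⟨(t₁.snd, d.fst), h02⟩
  let u : G.Dart := ⟨(d.snd, d₂.snd), h13⟩
  have n01 := d.fst_ne_snd
  have n12 : d.snd ≠ t₁.snd := e1 ▸ t₁.fst_ne_snd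
  have n02 : t₁.snd ≠ d.fst := h02.ne
  have n13 : d.snd ≠ d₂.snd := h13.ne
  have n23 : t₁.snd ≠ d₂.snd := e2 ▸ d₂.fst_ne_snd
  -- The unit circulation around the triangle on the first three vertices of the face walk. It
  -- bounds a face function `f`, the algebraic form of inside and outside.
  let g : G.Dart → ℝ := fun c =>
    (((if c = d then 1 else 0) + (if c = t₁ then 1 else 0)) + (if c = t₂ then 1 else 0)) -
    (((if c = d.symm then 1 else 0) + (if c = t₁.symm then 1 else 0)) +
      (if c = t₂.symm then 1 else 0))
  have hsymm : ∀ a b : G.Dart, a.symm = b ↔ a = b.symm :=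
    fun a b => ⟨fun h => by rw [← h, Dart.symm_symm], fun h => by rw [h, Dart.symm_symm]⟩
  have hg : ∀ c : G.Dart, g c.symm = - g c := by
    intro c
    simp only [g, hsymm, Dart.symm_symm]
    ring
  have hcirc : ∀ h : V → ℝ, ∑ c, g c * G.gradient h c = 0 := by
    intro h
    have hgr : ∀ c : G.Dart, G.gradient h c = h c.snd - h c.fst := fun _ => rfl
    simp only [g, sub_mul, add_mul, ite_mul, one_mul, zero_mul, Finset.sum_sub_distrib,
      Finset.sum_add_distrib, Finset.sum_ite_eq', Finset.mem_univ, if_true]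
    simp only [hgr, Dart.symm, Prod.swap, t₂, e1]
    ring
  obtain ⟨f, hf, hfg⟩ := R.exists_boundary_eq hR hg hcirc
  have hnext : ∀ c : G.Dart, f (R.next c) = f c - g c := by
    intro c
    have h1 := hf c.symm
    rw [facePerm_apply, Dart.symm_symm] at h1
    rw [h1, ← hfg c]
    ring
  have hgv : ∀ c : G.Dart, c.fst = d.snd →
      g c = (if c = t₁ then 1 else 0) - (if c = d.symm then 1 else 0) := by
    intro c hc
    have k1 : c ≠ d := by rintro rfl; exact n01 hc
    have k2 : c ≠ t₂ := by rintro rfl; exact n12 hc.symm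
    have k3 : c ≠ t₁.symm := by rintro rfl; exact n12 hc.symm
    have k4 : c ≠ t₂.symm := by rintro rfl; exact n01 hc
    simp [g, k1, k2, k3, k4]
  have hg3 : ∀ c : G.Dart, c.fst = d₂.snd → g c = 0 := by
    intro c hc
    have k0 : c ≠ d := by rintro rfl; exact h30 hc.symm
    have k1 : c ≠ t₁ := by rintro rfl; exact n13 (e1 ▸ hc)
    have k2 : c ≠ t₂ := by rintro rfl; exact n23 hc
    have k3 : c ≠ d.symm := by rintro rfl; exact n13 hc
    have k4 : c ≠ t₁.symm := by rintro rfl; exact n23 hc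
    have k5 : c ≠ t₂.symm := by rintro rfl; exact h30 hc.symm
    simp [g, k0, k1, k2, k3, k4, k5]
  -- Around `d.snd`, `f` has the value `f t₁` at `t₁` and one less at every other dart, in
  -- particular at the chord `u`. Around the fourth vertex `f` is constant, equal to its value on
  -- the face of `t₁`. The chord avoids the triangle, so `f` agrees on its two sides: a
  -- contradiction.
  have hi1 : (fun c : G.Dart => if c.fst = d.snd then f c - (if c = t₁ then 1 else 0) else 0) ∈
      invariants R.next := by
    intro c
    simp only [R.fst_next]
    by_cases hc : c.fst = d.snd
    · have h1 : R.next c = t₁ ↔ c = d.symm := by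
        rw [ht₁, facePerm_apply]
        exact (Equiv.injective _).eq_iff
      simp only [if_pos hc, h1]
      rw [hnext, hgv c hc]
      ring
    · simp only [if_neg hc]
  have hi3 : (fun c : G.Dart => if c.fst = d₂.snd then f c else 0) ∈ invariants R.next := by
    intro c
    simp only [R.fst_next]
    split_ifs with hc
    · rw [hnext, hg3 c hc, sub_zero]
    · rfl
  have hut : u ≠ t₁ := fun hc => n23 (congrArg (fun c : G.Dart => c.snd) hc).symm
  have r1 := apply_eq_of_sameCycle hi1 (R.sameCycle u t₁ e1.symm)
  simp only [u, e1, if_true] at r1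
  rw [if_neg hut] at r1
  have e3 : (R.facePerm d₂).fst = d₂.snd := R.fst_facePerm d₂
  have r3 := apply_eq_of_sameCycle hi3 (R.sameCycle u.symm (R.facePerm d₂) e3.symm)
  have e4 : u.symm.fst = d₂.snd := rfl
  simp only [e4, e3, if_true] at r3
  have r4 := hfg u.symm
  rw [hg3 _ e4, Dart.symm_symm] at r4
  have r5 : f (R.facePerm d₂) = f t₁ := by rw [hf, hd₂, hf]
  change f u - 0 = f t₁ - 1 at r1
  linarith

end RotationSystem

/-- A rotation system all of whose faces are triangles and in which all vertices have degree at
least three. -/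
structure RotationSystem.IsTriangular (R : RotationSystem G) : Prop where
  facePerm_cubed : ∀ d, R.facePerm (R.facePerm (R.facePerm d)) = d
  next_next_ne : ∀ d, R.next (R.next d) ≠ d

namespace RotationSystem

variable {R : RotationSystem G}

/-- The two triangles at a vertex of degree two have the same boundary, so the degree condition
passes to the next vertex of the triangle; going round, the graph is just that triangle. -/
theorem next_next_symm (h3 : ∀ d, R.facePerm (R.facePerm (R.facePerm d)) = d) {d : G.Dart}
    (hd : R.next (R.next d) = d) :
    R.next (R.next d.symm) = d.symm ∧ (R.next d.symm).snd = (R.next d).snd := by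
  have e1 : R.facePerm d.symm = R.next d := by rw [facePerm_apply, Dart.symm_symm]
  have e2 : R.facePerm (R.next d).symm = d := by rw [facePerm_apply, Dart.symm_symm, hd]
  have k1 : R.facePerm (R.facePerm (R.next d)) = d.symm := by rw [← e1, h3]
  have k2 : R.facePerm (R.facePerm d) = (R.next d).symm := by nth_rewrite 1 [← e2]; rw [h3]
  have f1 : (R.facePerm (R.next d)).snd = d.snd := by rw [← fst_facePerm, k1]; rfl
  have f2 : (R.facePerm d).snd = (R.next d).snd := by rw [← fst_facePerm, k2]; rfl
  have hm : R.facePerm d = (R.facePerm (R.next d)).symm :=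
    Dart.ext _ _ (Prod.ext ((R.fst_facePerm d).trans f1.symm)
      (f2.trans (R.fst_facePerm (R.next d)).symm))
  refine ⟨?_, f2⟩
  rw [← facePerm_apply, hm, ← facePerm_apply, k1]

theorem eq_or_eq_of_next_next [Finite V] {d : G.Dart} (hd : R.next (R.next d) = d) {w : V}
    (hw : G.Adj d.fst w) : w = d.snd ∨ w = (R.next d).snd := by
  obtain ⟨n, hn⟩ := (R.sameCycle d ⟨(d.fst, w), hw⟩ rfl).exists_nat_pow_eq
  have key : ∀ n : ℕ, (R.next ^ n) d = d ∨ (R.next ^ n) d = R.next d := by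
    intro n
    induction n with
    | zero => exact Or.inl rfl
    | succ n ih =>
      rw [pow_succ', mul_apply]
      rcases ih with h | h
      · exact Or.inr (by rw [h])
      · exact Or.inl (by rw [h, hd])
  rcases key n with h | h
  · exact Or.inl (congrArg (fun c : G.Dart => c.snd) (hn.symm.trans h))
  · exact Or.inr (congrArg (fun c : G.Dart => c.snd) (hn.symm.trans h))

theorem next_next_ne_of_card [Finite V] (hconn : G.Connected) (hcard : 4 ≤ Nat.card V)
    (h3 : ∀ d, R.facePerm (R.facePerm (R.facePerm d)) = d) (d : G.Dart) :
    R.next (R.next d) ≠ d := by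
  classical
  have := Fintype.ofFinite V
  intro hd
  have hd' : R.next (R.next (R.next d)) = R.next d := by rw [hd]
  obtain ⟨h1, h2⟩ := next_next_symm h3 hd
  obtain ⟨h4, h5⟩ := next_next_symm h3 hd'
  rw [hd] at h5
  let S : Finset V := {d.fst, d.snd, (R.next d).snd}
  have hall : ∀ z, z ∈ S := fun z =>
    Finset.mem_coe.1 (hconn.mem_of_forall_adj (S := S) (x := d.fst)
      (by simp [S]) (fun u hu w huw => by
        simp only [S, Finset.coe_insert, Finset.coe_singleton, Set.mem_insert_iff,
          Set.mem_singleton_iff] at hu ⊢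
        rcases hu with rfl | rfl | rfl
        · exact Or.inr (eq_or_eq_of_next_next hd huw)
        · rcases eq_or_eq_of_next_next h1 (w := w) huw with h | h
          · exact Or.inl h
          · exact Or.inr (Or.inr (h.trans h2))
        · rcases eq_or_eq_of_next_next h4 (w := w) huw with h | h
          · exact Or.inl (h.trans (R.fst_next d))
          · exact Or.inr (Or.inl (h.trans h5))) z)
  have k1 : (Finset.univ : Finset V).card ≤ S.card := Finset.card_le_card fun z _ => hall z
  have k2 : S.card ≤ 3 := Finset.card_le_three
  rw [Finset.card_univ, ← Nat.card_eq_fintype_card] at k1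
  omega

end RotationSystem

/-- Vertices sharing a face are adjacent by maximality, so a face walk not closing after three steps
would have two crossing chords. The dart count is Euler's formula with 3F = 2E. -/
theorem IsTriangulation.exists_isTriangular [Finite V] (hG : G.IsTriangulation)
    (hcard : 4 ≤ Nat.card V) :
    ∃ R : RotationSystem G, R.IsTriangular ∧ Nat.card G.Dart + 12 = 6 * Nat.card V := by
  classical
  have := Fintype.ofFinite V
  have : Nonempty V := Nat.card_pos_iff.1 (by omega) |>.1
  have hconn := hG.connected
  obtain ⟨R, hR⟩ := hG.1
  have hadj : ∀ c d : G.Dart, R.facePerm.SameCycle c d → c.fst ≠ d.fst → G.Adj c.fst d.fst := by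
    intro c d hcd hne
    by_contra hn
    exact hG.2 _ _ hne hn (R.isPlanar_sup_edge_of_sameCycle hR hcd hne hn)
  have hne : ∀ d : G.Dart, (R.facePerm d).snd ≠ d.fst := fun d hc =>
    R.next_ne hconn (by omega) hadj d.symm (Dart.ext _ _ (Prod.ext (R.fst_facePerm d) hc))
  have hper : ∀ d : G.Dart, (R.facePerm (R.facePerm d)).snd = d.fst := by
    intro d
    by_contra hc
    have hs2 : R.facePerm.SameCycle (R.facePerm (R.facePerm d)) d :=
      sameCycle_apply_left.2 (sameCycle_apply_left.2 (SameCycle.refl _ _))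
    have hs13 : R.facePerm.SameCycle (R.facePerm d)
        (R.facePerm (R.facePerm (R.facePerm d))) :=
      sameCycle_apply_right.2 (sameCycle_apply_right.2 (SameCycle.refl _ _))
    have h02 := hadj _ _ hs2 (by rw [R.fst_facePerm]; exact hne d)
    have h13 := hadj _ _ hs13 (by
      rw [R.fst_facePerm (R.facePerm (R.facePerm d))]; exact (hne (R.facePerm d)).symm)
    rw [R.fst_facePerm (R.facePerm d)] at h02
    rw [R.fst_facePerm d, R.fst_facePerm (R.facePerm (R.facePerm d))] at h13
    exact R.not_adj_and_adj hR h02 h13 hc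
  have h3 : ∀ d, R.facePerm (R.facePerm (R.facePerm d)) = d := by
    intro d
    refine Dart.ext _ _ (Prod.ext ?_ ?_)
    · exact (R.fst_facePerm _).trans (hper d)
    · exact (hper (R.facePerm d)).trans (R.fst_facePerm d)
  refine ⟨R, ⟨h3, R.next_next_ne_of_card hconn hcard h3⟩, ?_⟩
  have hF : Nat.card G.Dart = 3 * Nat.card R.Face :=
    card_eq_three_mul_card_quotient h3 fun d hc =>
      d.fst_ne_snd ((congrArg (fun c : G.Dart => c.fst) hc).symm.trans (R.fst_facePerm d))
  have hE : Nat.card G.Dart = 2 * Nat.card G.edgeSet := by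
    rw [Nat.card_eq_fintype_card, dart_card_eq_twice_card_edges, edgeFinset_card,
      ← Nat.card_eq_fintype_card]
  have hC : Nat.card G.ConnectedComponent = 1 := by
    have := hconn.preconnected.subsingleton_connectedComponent
    have : Nonempty G.ConnectedComponent := Nonempty.map G.connectedComponentMk ‹_›
    exact Nat.card_eq_one_iff_unique.2 ⟨inferInstance, inferInstance⟩
  have hI : Nat.card {x : V // ∀ y, ¬ G.Adj x y} = 0 := by
    have : IsEmpty {x : V // ∀ y, ¬ G.Adj x y} := ⟨fun ⟨x, hx⟩ => by
      have hall := hconn.mem_of_forall_adj (S := {x}) (x := x) rfl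
        (fun u hu w huw => absurd (hu ▸ huw) (hx w))
      have : Nat.card V ≤ 1 := by
        rw [Nat.card_eq_fintype_card, Fintype.card_le_one_iff]
        intro a b
        exact (hall a).trans (hall b).symm
      omega⟩
    exact Nat.card_of_isEmpty
  rw [RotationSystem.numFaces, hI, hC] at hR
  omega

end SimpleGraph

/-! ### Three colours on a cycle of nine points. -/

namespace Equiv.Perm

variable {D : Type*} [Finite D]

/-- Nine points on a cycle, three of each of three colours, with four colour changes: some point
separates two points that have the other two colours. -/
theorem exists_rainbow_of_four_changes [DecidableEq D] {τ : Perm D} {X : Finset D}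
    (hX : ∀ d, τ d ∈ X ↔ d ∈ X) (hτ : ∀ a ∈ X, ∀ b ∈ X, τ.SameCycle a b) (κ : D → Fin 3)
    (hcard : ∀ i, (X.filter fun e => κ e = i).card = 3)
    (hch : (X.filter fun e => κ (τ e) ≠ κ e).card = 4) :
    ∃ e ∈ X, κ (τ e) ≠ κ e ∧ κ (τ.symm e) ≠ κ e ∧ κ (τ e) ≠ κ (τ.symm e) := by
  by_contra! hno
  have hX' : ∀ d, τ.symm d ∈ X ↔ d ∈ X := fun d => by rw [← hX, apply_symm_apply]
  have hclosed : ∀ S : Set D, (∃ a ∈ X, a ∈ S) → (∀ e ∈ X, e ∈ S → τ e ∈ S) →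
      ∀ e ∈ X, e ∈ S := by
    rintro S ⟨a, haX, haS⟩ hS e he
    obtain ⟨n, rfl⟩ := (hτ a haX e he).exists_nat_pow_eq
    have key : ∀ n : ℕ, (τ ^ n) a ∈ X ∧ (τ ^ n) a ∈ S := by
      intro n
      induction n with
      | zero => exact ⟨haX, haS⟩
      | succ n ih =>
        rw [pow_succ', mul_apply]
        exact ⟨(hX _).2 ih.1, hS _ ih.1 ih.2⟩
    exact (key n).2
  let K : Fin 3 → Finset D := fun i => X.filter fun e => κ e = i
  let ends : Fin 3 → Finset D := fun i => (K i).filter fun e => κ (τ e) ≠ i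
  let starts : Fin 3 → Finset D := fun i => (K i).filter fun e => κ (τ.symm e) ≠ i
  have hne : ∀ i, ∃ e ∈ X, κ e = i := by
    intro i
    have : (X.filter fun e => κ e = i).Nonempty := Finset.card_pos.1 (by rw [hcard]; norm_num)
    obtain ⟨e, he⟩ := this
    exact ⟨e, (Finset.mem_filter.1 he).1, (Finset.mem_filter.1 he).2⟩
  have hpos : ∀ i, 1 ≤ (ends i).card := by
    intro i
    by_contra hc
    have h0 : ends i = ∅ := Finset.card_eq_zero.1 (by omega)
    obtain ⟨a, haX, hai⟩ := hne i
    obtain ⟨b, hbX, hbi⟩ := hne (i + 1)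
    have := hclosed {e | κ e = i} ⟨a, haX, hai⟩ (fun e he hei => by
      by_contra hc
      have : e ∈ ends i := Finset.mem_filter.2 ⟨Finset.mem_filter.2 ⟨he, hei⟩, hc⟩
      rw [h0] at this
      exact absurd this (Finset.notMem_empty _)) b hbX
    have h1 : ∀ i : Fin 3, i + 1 ≠ i := by decide
    exact h1 i (hbi.symm.trans this)
  have hsum : (ends 0).card + (ends 1).card + (ends 2).card = 4 := by
    have : ∀ i, (ends i) = (X.filter fun e => κ (τ e) ≠ κ e).filter fun e => κ e = i := by
      intro i
      ext e
      simp only [ends, K, Finset.mem_filter]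
      constructor
      · rintro ⟨⟨h1, rfl⟩, h3⟩; exact ⟨⟨h1, h3⟩, rfl⟩
      · rintro ⟨⟨h1, h3⟩, rfl⟩; exact ⟨⟨h1, rfl⟩, h3⟩
    simp only [this]
    have h := Finset.card_eq_sum_card_fiberwise (s := X.filter fun e => κ (τ e) ≠ κ e) (f := κ)
      (t := Finset.univ) (fun _ _ => Finset.mem_coe.2 (Finset.mem_univ _))
    rw [Fin.sum_univ_three, hch] at h
    exact h.symm
  -- Each colour has as many runs by first points as by last points.
  have hstarts : ∀ i, (starts i).card = (ends i).card := by
    intro i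
    have h1 : (starts i).card = (X.filter fun e => κ (τ e) = i ∧ κ e ≠ i).card := by
      refine Finset.card_bij' (fun e _ => τ.symm e) (fun e _ => τ e) ?_ ?_ ?_ ?_
      · intro e he
        simp only [starts, K, Finset.mem_filter] at he
        simp only [Finset.mem_filter, hX', apply_symm_apply]
        exact ⟨he.1.1, he.1.2, he.2⟩
      · intro e he
        simp only [Finset.mem_filter] at he
        simp only [starts, K, Finset.mem_filter, hX, symm_apply_apply]
        exact ⟨⟨he.1, he.2.1⟩, he.2.2⟩
      · simp
      · simp
    have h2 : (X.filter fun e => κ (τ e) = i).card = 3 := by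
      refine Eq.trans ?_ (hcard i)
      refine Finset.card_bij' (fun e _ => τ e) (fun e _ => τ.symm e) ?_ ?_ ?_ ?_
      · intro e he
        simpa only [Finset.mem_filter, hX] using he
      · intro e he
        simpa only [Finset.mem_filter, hX', apply_symm_apply] using he
      · simp
      · simp
    have h3 := Finset.card_filter_add_card_filter_not (s := X.filter fun e => κ (τ e) = i)
      (fun e => κ e = i)
    have h4 := Finset.card_filter_add_card_filter_not (s := X.filter fun e => κ e = i)
      (fun e => κ (τ e) = i)
    rw [Finset.filter_filter, Finset.filter_filter, h2] at h3
    rw [Finset.filter_filter, hcard] at h4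
    have h5 : (X.filter fun e => κ (τ e) = i ∧ κ e = i) =
        X.filter fun e => κ e = i ∧ κ (τ e) = i := by simp only [and_comm]
    rw [h5] at h3
    change _ + (ends i).card = 3 at h4
    change _ + (X.filter fun e => κ (τ e) = i ∧ κ e ≠ i).card = 3 at h3
    omega
  have hall : ∃ i, 2 ≤ (ends i).card ∧ ∀ j, j ≠ i → (ends j).card = 1 := by
    have h0 := hpos 0
    have h1 := hpos 1
    have h2 := hpos 2
    rcases (by omega : 2 ≤ (ends 0).card ∨ 2 ≤ (ends 1).card ∨ 2 ≤ (ends 2).card) with h | h | h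
    · refine ⟨0, h, fun j hj => ?_⟩
      fin_cases j
      · exact absurd rfl hj
      · change (ends 1).card = 1; omega
      · change (ends 2).card = 1; omega
    · refine ⟨1, h, fun j hj => ?_⟩
      fin_cases j
      · change (ends 0).card = 1; omega
      · exact absurd rfl hj
      · change (ends 2).card = 1; omega
    · refine ⟨2, h, fun j hj => ?_⟩
      fin_cases j
      · change (ends 0).card = 1; omega
      · change (ends 1).card = 1; omega
      · exact absurd rfl hj
  obtain ⟨i, hi, hothers⟩ := hall
  -- Two first points and two last points among three points of colour `i` must overlap, so some run
  -- is a single point `p`.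
  have hinter : (ends i ∩ starts i).Nonempty := by
    rw [← Finset.card_pos]
    have h1 := Finset.card_union_add_card_inter (ends i) (starts i)
    have h2 : (ends i ∪ starts i).card ≤ (K i).card :=
      Finset.card_le_card (Finset.union_subset (Finset.filter_subset _ _)
        (Finset.filter_subset _ _))
    have h3 : (K i).card = 3 := hcard i
    have h4 := hstarts i
    omega
  obtain ⟨p, hp⟩ := hinter
  simp only [Finset.mem_inter, ends, starts, K, Finset.mem_filter] at hp
  obtain ⟨⟨⟨hpX, hpi⟩, hp1⟩, -, hp2⟩ := hp
  have hpp := hno p hpX (by rw [hpi]; exact hp1) (by rw [hpi]; exact hp2)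
  have hend : τ.symm p ∈ ends (κ (τ p)) := by
    simp only [ends, K, Finset.mem_filter, apply_symm_apply]
    exact ⟨⟨(hX' p).2 hpX, hpp.symm⟩, by rw [hpi]; exact hp1.symm⟩
  obtain ⟨q, hq⟩ := Finset.card_eq_one.1 (hothers _ hp1)
  rw [hq, Finset.mem_singleton] at hend
  -- Both neighbours of `p` have the same colour, whose only run therefore ends just before `p`.
  -- Then `p` and that run fill the whole cycle, leaving no room for the third colour.
  have hS := hclosed {e | e = p ∨ κ e = κ (τ p)} ⟨p, hpX, Or.inl rfl⟩ (by
    rintro e he (rfl | hek)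
    · exact Or.inr rfl
    · by_cases hc : κ (τ e) = κ (τ p)
      · exact Or.inr hc
      · have : e ∈ ends (κ (τ p)) := by
          simp only [ends, K, Finset.mem_filter]
          exact ⟨⟨he, hek⟩, hc⟩
        rw [hq, Finset.mem_singleton] at this
        rw [this, ← hend, apply_symm_apply]
        exact Or.inl rfl)
  have h3 : ∀ a b : Fin 3, ∃ c, c ≠ a ∧ c ≠ b := by decide
  obtain ⟨k, hki, hkj⟩ := h3 i (κ (τ p))
  obtain ⟨e, heX, hek⟩ := hne k
  rcases hS e heX with rfl | h
  · exact hki (hek.symm.trans hpi)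
  · exact hkj (hek.symm.trans h)

end Equiv.Perm

/-! ### Local structure of triangular rotation systems. -/

namespace SimpleGraph

variable {V : Type*} {G : SimpleGraph V}

open Equiv Equiv.Perm

namespace RotationSystem

variable {R : RotationSystem G}

/-- The end of the dart that follows a given dart on the face boundary. In a triangular face this
is the vertex opposite to the dart. -/
def third (R : RotationSystem G) (d : G.Dart) : V := (R.facePerm d).snd

theorem third_symm (d : G.Dart) : R.third d.symm = (R.next d).snd := by
  rw [third, facePerm_apply, Dart.symm_symm]

theorem adj_snd_third (d : G.Dart) : G.Adj d.snd (R.third d) := by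
  have := (R.facePerm d).adj
  rwa [R.fst_facePerm] at this

namespace IsTriangular

variable (hR : R.IsTriangular)

include hR

theorem third_facePerm (d : G.Dart) : R.third (R.facePerm d) = d.fst := by
  rw [third, ← R.fst_facePerm, hR.facePerm_cubed]

theorem third_facePerm_facePerm (d : G.Dart) : R.third (R.facePerm (R.facePerm d)) = d.snd := by
  rw [hR.third_facePerm, R.fst_facePerm]

theorem third_next (d : G.Dart) : R.third (R.next d) = d.snd := by
  have := hR.third_facePerm d.symm
  rwa [facePerm_apply, Dart.symm_symm] at this

theorem adj_fst_third (d : G.Dart) : G.Adj d.fst (R.third d) := by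
  have := adj_snd_third (R := R) (R.facePerm d)
  rw [hR.third_facePerm] at this
  exact this.symm

/-- If the two faces at `d` had the same third vertex, the dart to it would both follow and precede
`d` in the rotation at `d.fst`. -/
theorem third_ne_third_symm (d : G.Dart) : R.third d ≠ R.third d.symm := by
  intro hc
  have h1 : (R.facePerm (R.facePerm d)).symm = R.next d := by
    refine Dart.ext _ _ (Prod.ext ?_ ?_)
    · exact (hR.third_facePerm d).trans (R.fst_next d).symm
    · rw [← third_symm, ← hc]
      exact R.fst_facePerm _
  apply hR.next_next_ne d
  rw [← h1, ← facePerm_apply, hR.facePerm_cubed]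

theorem exists_common_neighbors {x y : V} (h : G.Adj x y) :
    ∃ w w', w ≠ w' ∧ G.Adj x w ∧ G.Adj y w ∧ G.Adj x w' ∧ G.Adj y w' :=
  let d : G.Dart := ⟨(x, y), h⟩
  ⟨R.third d, R.third d.symm, hR.third_ne_third_symm d, hR.adj_fst_third d, adj_snd_third d,
    adj_snd_third d.symm, hR.adj_fst_third d.symm⟩

theorem thirds_subset [Fintype V] [DecidableEq V] [DecidableRel G.Adj] (d : G.Dart) :
    {d.snd, R.third d, R.third d.symm} ⊆ G.neighborFinset d.fst := by
  intro z hz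
  simp only [Finset.mem_insert, Finset.mem_singleton] at hz
  rw [mem_neighborFinset]
  rcases hz with rfl | rfl | rfl
  · exact d.adj
  · exact hR.adj_fst_third d
  · exact adj_snd_third d.symm

theorem card_thirds [DecidableEq V] (d : G.Dart) :
    ({d.snd, R.third d, R.third d.symm} : Finset V).card = 3 :=
  Finset.card_eq_three.2 ⟨_, _, _, (adj_snd_third d).ne,
    (hR.adj_fst_third d.symm).ne, hR.third_ne_third_symm d, rfl⟩

theorem eq_or_eq_or_eq_of_degree_eq_three [Fintype V] [DecidableRel G.Adj] {d : G.Dart}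
    (hd : G.degree d.fst = 3) {w : V} (hw : G.Adj d.fst w) :
    w = d.snd ∨ w = R.third d ∨ w = R.third d.symm := by
  classical
  have heq := Finset.eq_of_subset_of_card_le (hR.thirds_subset d) (by
    rw [hR.card_thirds, card_neighborFinset_eq_degree, hd])
  have : w ∈ G.neighborFinset d.fst := (G.mem_neighborFinset _ _).2 hw
  rw [← heq] at this
  simpa using this

theorem three_le_degree [Fintype V] [DecidableRel G.Adj] (d : G.Dart) : 3 ≤ G.degree d.fst := by
  classical
  rw [← hR.card_thirds d, ← card_neighborFinset_eq_degree]
  exact Finset.card_le_card (hR.thirds_subset d)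

end IsTriangular

theorem adj_cases_of_next_cubed [Finite V] {d : G.Dart} (hd : R.next (R.next (R.next d)) = d)
    {w : V} (hw : G.Adj d.fst w) :
    w = d.snd ∨ w = (R.next d).snd ∨ w = (R.next (R.next d)).snd := by
  obtain ⟨n, hn⟩ := (R.sameCycle d ⟨(d.fst, w), hw⟩ rfl).exists_nat_pow_eq
  have key : ∀ n : ℕ, (R.next ^ n) d = d ∨ (R.next ^ n) d = R.next d ∨
      (R.next ^ n) d = R.next (R.next d) := by
    intro n
    induction n with
    | zero => exact Or.inl rfl
    | succ n ih =>
      rw [pow_succ', mul_apply]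
      rcases ih with h | h | h
      · exact Or.inr (Or.inl (by rw [h]))
      · exact Or.inr (Or.inr (by rw [h]))
      · exact Or.inl (by rw [h, hd])
  rcases key n with h | h | h
  · exact Or.inl (congrArg (fun c : G.Dart => c.snd) (hn.symm.trans h))
  · exact Or.inr (Or.inl (congrArg (fun c : G.Dart => c.snd) (hn.symm.trans h)))
  · exact Or.inr (Or.inr (congrArg (fun c : G.Dart => c.snd) (hn.symm.trans h)))

end RotationSystem

end SimpleGraph

/-! ### A vertex with three non-neighbours. -/

namespace SimpleGraph

variable {V : Type*} {G : SimpleGraph V}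

open Equiv Equiv.Perm

theorem induce_star_connected {S : Set V} {c : V} (hc : c ∈ S)
    (hS : ∀ x ∈ S, x = c ∨ G.Adj c x) : (G.induce S).Connected := by
  have : Nonempty S := ⟨⟨c, hc⟩⟩
  have hr : ∀ x : S, (G.induce S).Reachable ⟨c, hc⟩ x := by
    rintro ⟨x, hx⟩
    rcases hS x hx with rfl | h
    · exact Reachable.refl _
    · exact Adj.reachable (G := G.induce S) (u := ⟨c, hc⟩) (v := ⟨x, hx⟩) h
  exact ⟨fun x y => (hr x).symm.trans (hr y)⟩

theorem exists_not_dominated_of_star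
    (hno : ∀ S : Finset V, S.card ≤ 3 → ¬ G.IsConnectedDominatingSet (S : Set V)) {c x y : V}
    (hx : G.Adj c x) (hy : G.Adj c y) :
    ∃ z, (z ≠ c ∧ z ≠ x ∧ z ≠ y) ∧ ¬ G.Adj c z ∧ ¬ G.Adj x z ∧ ¬ G.Adj y z := by
  classical
  by_contra! hdom
  refine hno {c, x, y} Finset.card_le_three ⟨fun z => ?_, induce_star_connected (c := c) ?_ ?_⟩
  · simp only [Finset.coe_insert, Finset.coe_singleton, Set.mem_insert_iff,
      Set.mem_singleton_iff, exists_eq_or_imp, exists_eq_left]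
    by_contra! hz
    exact hz.2.2.2 (hdom z ⟨hz.1.1, hz.1.2.1, hz.1.2.2⟩ (fun h => hz.2.1 h.symm)
      (fun h => hz.2.2.1 h.symm)).symm
  · simp
  · intro z hz
    simp only [Finset.coe_insert, Finset.coe_singleton, Set.mem_insert_iff,
      Set.mem_singleton_iff] at hz
    rcases hz with rfl | rfl | rfl
    · exact Or.inl rfl
    · exact Or.inr hx
    · exact Or.inr hy

variable [Fintype V] [DecidableRel G.Adj] {R : RotationSystem G}

/-- A vertex with exactly three non-neighbours in a triangulation without a connected dominating
set of at most three vertices: the non-neighbours have disjoint neighbourhoods, consisting of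
neighbours of the vertex. -/
theorem RotationSystem.IsTriangular.neighbors_of_no_dominating (hR : R.IsTriangular)
    (hno : ∀ S : Finset V, S.card ≤ 3 → ¬ G.IsConnectedDominatingSet (S : Set V))
    (hpos : ∀ x, ∃ y, G.Adj x y) {v : V} {u : Fin 3 → V}
    (hv : ∀ x, ¬ G.Adj v x ↔ x = v ∨ ∃ i, x = u i) (huv : ∀ i, u i ≠ v) :
    (∀ i x, G.Adj (u i) x → G.Adj v x) ∧ ∀ x i j, G.Adj (u i) x → G.Adj (u j) x → i = j := by
  have hvu : ∀ i, ¬ G.Adj v (u i) := fun i => (hv _).2 (Or.inr ⟨i, rfl⟩)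
  have huadj : ∀ i x, G.Adj (u i) x → ¬ G.Adj v x → ∃ j, j ≠ i ∧ x = u j := by
    intro i x hx hxv
    rcases (hv x).1 hxv with rfl | ⟨j, rfl⟩
    · exact absurd hx.symm (hvu i)
    · exact ⟨j, by rintro rfl; exact hx.ne rfl, rfl⟩
  -- `u i` has three distinct neighbours, too many for the other two non-neighbours of `v`.
  have hexists : ∀ i, ∃ x, G.Adj (u i) x ∧ G.Adj v x := by
    intro i
    by_contra! hc
    obtain ⟨y, hy⟩ := hpos (u i)
    obtain ⟨w, w', hww', hw, hyw, hw', hyw'⟩ := hR.exists_common_neighbors hy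
    obtain ⟨j, hj, rfl⟩ := huadj i y hy (hc y hy)
    obtain ⟨k, hk, rfl⟩ := huadj i w hw (hc w hw)
    obtain ⟨l, hl, rfl⟩ := huadj i w' hw' (hc w' hw')
    have h1 : j ≠ k := by rintro rfl; exact hyw.ne rfl
    have h2 : j ≠ l := by rintro rfl; exact hyw'.ne rfl
    have h3 : k ≠ l := by rintro rfl; exact hww' rfl
    omega
  have huniq : ∀ x i j, G.Adj v x → G.Adj (u i) x → G.Adj (u j) x → i = j := by
    intro x i j hx hi hj
    by_contra hij
    have h3 : ∀ i j : Fin 3, i ≠ j → ∃ k, ∀ l, l = i ∨ l = j ∨ l = k := by decide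
    obtain ⟨k, hk⟩ := h3 i j hij
    obtain ⟨y, hky, hy⟩ := hexists k
    obtain ⟨z, ⟨hzv, -, -⟩, hvz, hxz, hyz⟩ := exists_not_dominated_of_star hno hx hy
    rcases (hv z).1 hvz with rfl | ⟨l, rfl⟩
    · exact hzv rfl
    · rcases hk l with rfl | rfl | rfl
      · exact hxz hi.symm
      · exact hxz hj.symm
      · exact hyz hky.symm
  -- Two common neighbours of `u i` and `u j` would lie outside N(v) by `huniq`, but only one
  -- non-neighbour of `v` is left.
  have hindep : ∀ i j, ¬ G.Adj (u i) (u j) := by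
    intro i j hij
    have hne : i ≠ j := by rintro rfl; exact hij.ne rfl
    obtain ⟨w, w', hww', hw, hjw, hw', hjw'⟩ := hR.exists_common_neighbors hij
    have hv1 : ¬ G.Adj v w := fun h => hne (huniq w i j h hw hjw)
    have hv2 : ¬ G.Adj v w' := fun h => hne (huniq w' i j h hw' hjw')
    obtain ⟨k, hk, rfl⟩ := huadj i w hw hv1
    obtain ⟨l, hl, rfl⟩ := huadj i w' hw' hv2
    have h1 : j ≠ k := by rintro rfl; exact hjw.ne rfl
    have h2 : j ≠ l := by rintro rfl; exact hjw'.ne rfl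
    have h3 : k ≠ l := by rintro rfl; exact hww' rfl
    omega
  have hN : ∀ i x, G.Adj (u i) x → G.Adj v x := by
    intro i x hx
    by_contra hc
    obtain ⟨j, -, rfl⟩ := huadj i x hx hc
    exact hindep i j hx
  exact ⟨hN, fun x i j hi hj => huniq x i j (hN i x hi) hi hj⟩

/-- Three disjoint sets of size at least 3 in a set of size at most 9 fill it exactly. -/
theorem degree_eq_of_disjoint_neighbors {v : V} {u : Fin 3 → V}
    (hN : ∀ i x, G.Adj (u i) x → G.Adj v x)
    (huniq : ∀ x i j, G.Adj (u i) x → G.Adj (u j) x → i = j)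
    (hdeg : ∀ i, 3 ≤ G.degree (u i)) (hdv : G.degree v ≤ 9) :
    G.degree v = 9 ∧ (∀ i, G.degree (u i) = 3) ∧ ∀ x, G.Adj v x → ∃ i, G.Adj (u i) x := by
  classical
  have hsub : Finset.univ.biUnion (fun i => G.neighborFinset (u i)) ⊆ G.neighborFinset v := by
    intro x hx
    simp only [Finset.mem_biUnion, mem_neighborFinset] at hx ⊢
    obtain ⟨i, -, hi⟩ := hx
    exact hN i x hi
  have hcard : (Finset.univ.biUnion (fun i => G.neighborFinset (u i))).card =
      G.degree (u 0) + G.degree (u 1) + G.degree (u 2) := by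
    rw [Finset.card_biUnion, Fin.sum_univ_three]
    · rfl
    · intro i _ j _ hij
      rw [Function.onFun, Finset.disjoint_left]
      intro x hi hj
      rw [mem_neighborFinset] at hi hj
      exact hij (huniq x i j hi hj)
  have hle := Finset.card_le_card hsub
  rw [hcard, card_neighborFinset_eq_degree] at hle
  have h0 := hdeg 0
  have h1 := hdeg 1
  have h2 := hdeg 2
  have heq := Finset.eq_of_subset_of_card_le hsub (by
    rw [hcard, card_neighborFinset_eq_degree]; omega)
  refine ⟨by omega, fun i => ?_, fun x hx => ?_⟩
  · fin_cases i
    · change G.degree (u 0) = 3; omega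
    · change G.degree (u 1) = 3; omega
    · change G.degree (u 2) = 3; omega
  · have : x ∈ G.neighborFinset v := (G.mem_neighborFinset _ _).2 hx
    rw [← heq] at this
    simp only [Finset.mem_biUnion, mem_neighborFinset] at this
    obtain ⟨i, -, hi⟩ := this
    exact ⟨i, hi⟩

theorem card_filter_equiv {D : Type*} [Fintype D] (π : Perm D) (P : D → Prop) [DecidablePred P] :
    (Finset.univ.filter fun d => P (π d)).card = (Finset.univ.filter P).card := by
  refine Finset.card_bij' (fun d _ => π d) (fun d _ => π.symm d) ?_ ?_ ?_ ?_ <;> simp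

theorem card_dart_fst [DecidableEq V] (x : V) :
    (Finset.univ.filter fun d : G.Dart => d.fst = x).card = G.degree x :=
  G.dart_fst_fiber_card_eq_degree x

/-! ### Counting faces and coloured edges around the capped vertex. -/

section

set_option linter.unusedSectionVars false

variable [DecidableEq V] {v : V} {u : Fin 3 → V} {κ : V → Fin 3}

/-- A triangulation on thirteen vertices with a vertex `v` of degree nine whose non-neighbours `u i`
have degree three and pairwise disjoint neighbourhoods, the colour classes of `κ`, within the
neighbourhood of `v`. -/
structure IsThreeCapped (G : SimpleGraph V) [DecidableRel G.Adj] (v : V) (u : Fin 3 → V)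
    (κ : V → Fin 3) : Prop where
  injective : Function.Injective u
  not_adj_iff : ∀ x, ¬ G.Adj v x ↔ x = v ∨ ∃ i, x = u i
  ne : ∀ i, u i ≠ v
  adj_of_adj : ∀ i x, G.Adj (u i) x → G.Adj v x
  adj_iff : ∀ i x, G.Adj v x → (G.Adj (u i) x ↔ κ x = i)
  degree_eq_nine : G.degree v = 9
  degree_eq_three : ∀ i, G.degree (u i) = 3
  card_dart : Fintype.card G.Dart = 66

namespace IsThreeCapped

variable (h : IsThreeCapped G v u κ)

include h

theorem eq_color {i : Fin 3} {x : V} (hx : G.Adj (u i) x) : κ x = i :=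
  (h.adj_iff i x (h.adj_of_adj i x hx)).1 hx

theorem adj_color {x : V} (hx : G.Adj v x) : G.Adj (u (κ x)) x :=
  (h.adj_iff _ x hx).2 rfl

theorem adj_of_not_adj {x y : V} (hx : ¬ G.Adj v x) (hxy : G.Adj x y) : G.Adj v y := by
  rcases (h.not_adj_iff x).1 hx with rfl | ⟨i, rfl⟩
  · exact hxy
  · exact h.adj_of_adj i y hxy

theorem not_adj (i : Fin 3) : ¬ G.Adj v (u i) := (h.not_adj_iff _).2 (Or.inr ⟨i, rfl⟩)

theorem card_fst_eq : (Finset.univ.filter fun d : G.Dart => d.fst = v).card = 9 := by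
  rw [card_dart_fst, h.degree_eq_nine]

theorem card_fst_mem : (Finset.univ.filter fun d : G.Dart => ∃ i, d.fst = u i).card = 9 := by
  have : (Finset.univ.filter fun d : G.Dart => ∃ i, d.fst = u i) =
      Finset.univ.biUnion fun i => Finset.univ.filter fun d : G.Dart => d.fst = u i := by
    ext d; simp
  rw [this, Finset.card_biUnion]
  · simp only [card_dart_fst, h.degree_eq_three]; rfl
  · intro i _ j _ hij
    rw [Function.onFun, Finset.disjoint_left]
    intro d hi hj
    rw [Finset.mem_filter] at hi hj
    exact hij (h.injective (hi.2.symm.trans hj.2))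

theorem card_not_adj_fst : (Finset.univ.filter fun d : G.Dart => ¬ G.Adj v d.fst).card = 18 := by
  have : (Finset.univ.filter fun d : G.Dart => ¬ G.Adj v d.fst) =
      (Finset.univ.filter fun d : G.Dart => d.fst = v) ∪
        Finset.univ.filter fun d : G.Dart => ∃ i, d.fst = u i := by
    ext d
    rw [← Finset.filter_or, Finset.mem_filter, Finset.mem_filter, h.not_adj_iff]
  rw [this, Finset.card_union_of_disjoint, h.card_fst_eq, h.card_fst_mem]
  rw [Finset.disjoint_left]
  intro d hd hd'
  rw [Finset.mem_filter] at hd hd'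
  obtain ⟨-, i, hi⟩ := hd'
  exact h.ne i (hi.symm.trans hd.2)

variable (hR : R.IsTriangular)

include hR

theorem card_third_eq : (Finset.univ.filter fun d : G.Dart => R.third d = v).card = 9 := by
  rw [← h.card_fst_eq, ← card_filter_equiv R.facePerm]
  simp only [hR.third_facePerm]

theorem card_third_mem :
    (Finset.univ.filter fun d : G.Dart => ∃ i, R.third d = u i).card = 9 := by
  rw [← h.card_fst_mem, ← card_filter_equiv R.facePerm]
  simp only [hR.third_facePerm]

/-- The number of darts of faces all of whose vertices are adjacent to `v`. -/
theorem card_adj_adj_adj : (Finset.univ.filter fun d : G.Dart =>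
    G.Adj v d.fst ∧ G.Adj v d.snd ∧ G.Adj v (R.third d)).card = 12 := by
  have h1 := h.card_not_adj_fst
  have h2 : (Finset.univ.filter fun d : G.Dart => ¬ G.Adj v d.snd).card = 18 := by
    rw [← h1, ← card_filter_equiv R.facePerm (fun d => ¬ G.Adj v d.fst)]
    simp only [R.fst_facePerm]
  have h3 : (Finset.univ.filter fun d : G.Dart => ¬ G.Adj v (R.third d)).card = 18 := by
    rw [← h1, ← card_filter_equiv R.facePerm]
    simp only [hR.third_facePerm]
  -- The non-neighbours of `v` (itself included) are independent, so a face contains at most one of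
  -- them and the three sets of 18 darts are disjoint.
  have h4 : (Finset.univ.filter fun d : G.Dart =>
      ¬ (G.Adj v d.fst ∧ G.Adj v d.snd ∧ G.Adj v (R.third d))).card = 54 := by
    have : (Finset.univ.filter fun d : G.Dart =>
      ¬ (G.Adj v d.fst ∧ G.Adj v d.snd ∧ G.Adj v (R.third d))) =
      (Finset.univ.filter fun d : G.Dart => ¬ G.Adj v d.fst) ∪
        ((Finset.univ.filter fun d : G.Dart => ¬ G.Adj v d.snd) ∪
        Finset.univ.filter fun d : G.Dart => ¬ G.Adj v (R.third d)) := by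
      ext d
      simp only [Finset.mem_union, Finset.mem_filter, Finset.mem_univ, true_and]
      tauto
    rw [this, Finset.card_union_of_disjoint, Finset.card_union_of_disjoint, h1, h2, h3]
    · rw [Finset.disjoint_left]
      intro d hd hd'
      rw [Finset.mem_filter] at hd hd'
      exact hd'.2 (h.adj_of_not_adj hd.2 (RotationSystem.adj_snd_third d))
    · rw [Finset.disjoint_left]
      intro d hd hd'
      rw [Finset.mem_union, Finset.mem_filter, Finset.mem_filter] at hd'
      rw [Finset.mem_filter] at hd
      rcases hd' with hd' | hd'
      · exact hd'.2 (h.adj_of_not_adj hd.2 d.adj)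
      · exact hd'.2 (h.adj_of_not_adj hd.2 (hR.adj_fst_third d))
  have h5 := Finset.card_filter_add_card_filter_not (s := (Finset.univ : Finset G.Dart))
    (fun d => G.Adj v d.fst ∧ G.Adj v d.snd ∧ G.Adj v (R.third d))
  rw [h4, Finset.card_univ, h.card_dart] at h5
  omega

/-- The three faces at a vertex of degree 3 cover all pairs of its neighbours, so an edge within a
colour class borders a face at its `u i`. -/
theorem third_mem_or {d : G.Dart} (h1 : G.Adj v d.fst) (h2 : G.Adj v d.snd)
    (h12 : κ d.fst = κ d.snd) :
    R.third d = u (κ d.fst) ∨ R.third d.symm = u (κ d.fst) := by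
  let A : G.Dart := ⟨(u (κ d.fst), d.fst), h.adj_color h1⟩
  have hw : G.Adj A.fst d.snd := by
    have := h.adj_color h2
    rwa [← h12] at this
  rcases hR.eq_or_eq_or_eq_of_degree_eq_three (h.degree_eq_three _) hw with h3 | h3 | h3
  · exact absurd h3.symm d.fst_ne_snd
  · left
    have : R.facePerm A = d := Dart.ext _ _ (Prod.ext (R.fst_facePerm A) h3.symm)
    rw [← this, hR.third_facePerm, this]
  · right
    have e1 : R.facePerm (R.facePerm A.symm) = d.symm := by
      refine Dart.ext _ _ (Prod.ext ?_ ?_)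
      · exact (R.fst_facePerm _).trans h3.symm
      · exact hR.third_facePerm A.symm
    rw [← e1, hR.third_facePerm_facePerm]; rfl

/-- The number of darts joining neighbours of `v` of the same colour. -/
theorem card_same_color : (Finset.univ.filter fun d : G.Dart =>
    G.Adj v d.fst ∧ G.Adj v d.snd ∧ κ d.fst = κ d.snd).card = 18 := by
  have h1 := h.card_third_mem hR
  have h2 : (Finset.univ.filter fun d : G.Dart => ∃ i, R.third d.symm = u i).card = 9 := by
    rw [← h1, ← card_filter_equiv G.dartSymm (fun d => ∃ i, R.third d = u i)]
    rfl
  have : (Finset.univ.filter fun d : G.Dart =>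
      G.Adj v d.fst ∧ G.Adj v d.snd ∧ κ d.fst = κ d.snd) =
      (Finset.univ.filter fun d : G.Dart => ∃ i, R.third d = u i) ∪
        Finset.univ.filter fun d : G.Dart => ∃ i, R.third d.symm = u i := by
    ext d
    rw [← Finset.filter_or, Finset.mem_filter, Finset.mem_filter]
    refine and_congr_right fun _ => ⟨?_, ?_⟩
    · rintro ⟨k1, k2, k3⟩
      exact (h.third_mem_or hR k1 k2 k3).imp (fun k => ⟨_, k⟩) (fun k => ⟨_, k⟩)
    · rintro (⟨i, hi⟩ | ⟨i, hi⟩)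
      · have k1 := (hR.adj_fst_third d).symm
        have k2 := (RotationSystem.adj_snd_third (R := R) d).symm
        rw [hi] at k1 k2
        exact ⟨h.adj_of_adj i _ k1, h.adj_of_adj i _ k2,
          (h.eq_color k1).trans (h.eq_color k2).symm⟩
      · have k1 := (hR.adj_fst_third d.symm).symm
        have k2 := (RotationSystem.adj_snd_third (R := R) d.symm).symm
        rw [hi] at k1 k2
        exact ⟨h.adj_of_adj i _ k2, h.adj_of_adj i _ k1,
          (h.eq_color k2).trans (h.eq_color k1).symm⟩
  rw [this, Finset.card_union_of_disjoint, h1, h2]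
  rw [Finset.disjoint_left]
  intro d hd hd'
  rw [Finset.mem_filter] at hd hd'
  obtain ⟨-, i, hi⟩ := hd
  obtain ⟨-, j, hj⟩ := hd'
  have k1 := (hR.adj_fst_third d).symm
  have k2 := (RotationSystem.adj_snd_third (R := R) d.symm).symm
  rw [hi] at k1
  rw [hj] at k2
  have hij : i = j := (h.eq_color k1).symm.trans (h.eq_color k2)
  exact hR.third_ne_third_symm d (by rw [hi, hj, hij])

/-- The two edges of the face at `d.fst` have the same `u i` on their other sides. This closes the
rotation at `d.fst` after three darts, none of which leads to `v`. -/
theorem not_monochromatic {d : G.Dart} (h1 : G.Adj v d.fst) (h2 : G.Adj v d.snd)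
    (h3 : G.Adj v (R.third d)) (h12 : κ d.fst = κ d.snd) (h23 : κ d.snd = κ (R.third d)) :
    False := by
  have key : ∀ c : G.Dart, G.Adj v c.fst → G.Adj v c.snd → κ c.fst = κ c.snd →
      G.Adj v (R.third c) → R.third c.symm = u (κ c.fst) := by
    intro c k1 k2 k12 k3
    refine (h.third_mem_or hR k1 k2 k12).resolve_left fun hc => ?_
    rw [hc] at k3
    exact h.not_adj _ k3
  set e := R.facePerm (R.facePerm d) with he
  have e1 : e.fst = R.third d := R.fst_facePerm _
  have e2 : e.snd = d.fst := hR.third_facePerm d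
  have e3 : R.third e = d.snd := hR.third_facePerm_facePerm d
  have r1 := key d h1 h2 h12 h3
  have r2 := key e (by rwa [e1]) (by rwa [e2]) (by rw [e1, e2, h12, h23]) (by rwa [e3])
  have n1 : R.next e.symm = d := hR.facePerm_cubed d
  have n2 : (R.next d).snd = u (κ d.fst) := by rw [← RotationSystem.third_symm, r1]
  let A : G.Dart := ⟨(u (κ d.fst), d.fst), h.adj_color h1⟩
  have n3 : R.next d = A.symm :=
    Dart.ext _ _ (Prod.ext (R.fst_next d) n2)
  have n4 : R.facePerm (R.facePerm e.symm) = A := by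
    refine Dart.ext _ _ (Prod.ext ?_ ?_)
    · refine (R.fst_facePerm _).trans ?_
      change R.third e.symm = _
      rw [r2, e1, ← h23, ← h12]
    · refine (hR.third_facePerm e.symm).trans ?_
      exact e2
  have n5 : R.next A.symm = e.symm := by
    rw [← RotationSystem.facePerm_apply, ← n4, hR.facePerm_cubed]
  have n6 : R.next (R.next (R.next d)) = d := by rw [n3, n5, n1]
  rcases RotationSystem.adj_cases_of_next_cubed n6 h1.symm with k | k | k
  · rw [← k] at h2; exact h2.ne rfl
  · rw [n3] at k; exact h.ne _ k.symm
  · rw [n3, n5] at k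
    change v = e.fst at k
    rw [e1] at k
    rw [← k] at h3; exact h3.ne rfl

end IsThreeCapped

end

end SimpleGraph

/-! ### The rainbow path and the conclusion. -/

namespace SimpleGraph

variable {V : Type*} {G : SimpleGraph V}

open Equiv Equiv.Perm

theorem two_le_card_of_isConnectedDominatingSet [Fintype V] [DecidableRel G.Adj]
    {S : Finset V}
    (hS : G.IsConnectedDominatingSet (S : Set V))
    (hdeg : G.maxDegree + 1 < Fintype.card V) : 2 ≤ S.card := by
  classical
  by_contra hc
  obtain ⟨⟨c, hcS⟩⟩ := hS.2.nonempty
  have h1 : S = {c} := by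
    refine Finset.eq_singleton_iff_unique_mem.2 ⟨hcS, fun x hx => ?_⟩
    exact Finset.card_le_one.1 (by omega) x hx c hcS
  have h2 : (Finset.univ : Finset V) ⊆ insert c (G.neighborFinset c) := by
    intro x _
    rcases hS.1 x with hx | ⟨y, hy, hxy⟩
    · rw [h1, Finset.coe_singleton] at hx
      rw [hx]
      exact Finset.mem_insert_self _ _
    · rw [h1, Finset.coe_singleton] at hy
      rw [hy] at hxy
      exact Finset.mem_insert_of_mem ((G.mem_neighborFinset _ _).2 hxy.symm)
  have h3 := (Finset.card_le_card h2).trans (Finset.card_insert_le _ _)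
  rw [Finset.card_univ, card_neighborFinset_eq_degree] at h3
  have := G.degree_le_maxDegree c
  omega

variable [Fintype V] [DecidableEq V] [DecidableRel G.Adj] {R : RotationSystem G}
  {v : V} {u : Fin 3 → V} {κ : V → Fin 3}

namespace IsThreeCapped

set_option linter.unusedSectionVars false

variable (h : IsThreeCapped G v u κ) (hR : R.IsTriangular)

include h hR

theorem adj_of_color_eq {x y : V} (hx : G.Adj v x) (hy : G.Adj v y) (hxy : κ x = κ y)
    (hne : x ≠ y) : G.Adj x y := by
  let A : G.Dart := ⟨(u (κ x), x), h.adj_color hx⟩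
  have hw : G.Adj A.fst y := by
    have := h.adj_color hy
    rwa [← hxy] at this
  rcases hR.eq_or_eq_or_eq_of_degree_eq_three (h.degree_eq_three _) hw with h3 | h3 | h3
  · exact absurd h3.symm hne
  · rw [h3]; exact RotationSystem.adj_snd_third A
  · rw [h3]; exact hR.adj_fst_third A.symm

/-- The colour classes are cliques, so a path meeting all three dominates N(v) and every `u i`; it
dominates `v` as well, being in N(v). -/
theorem not_rainbow
    (hno : ∀ S : Finset V, S.card ≤ 3 → ¬ G.IsConnectedDominatingSet (S : Set V))
    {x y z : V} (hx : G.Adj v x) (hy : G.Adj v y) (hz : G.Adj v z)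
    (hyx : G.Adj y x) (hyz : G.Adj y z) :
    κ x = κ y ∨ κ z = κ y ∨ κ x = κ z := by
  by_contra! hc
  obtain ⟨q, ⟨hqy, hqx, hqz⟩, ay, ax, az⟩ := exists_not_dominated_of_star hno hyx hyz
  have h3 : ∀ a b c d : Fin 3, a ≠ b → c ≠ b → a ≠ c → d = b ∨ d = a ∨ d = c := by decide
  by_cases hq : G.Adj v q
  · rcases h3 _ _ _ (κ q) hc.1 hc.2.1 hc.2.2 with k | k | k
    · exact ay (h.adj_of_color_eq hR hy hq k.symm hqy.symm)
    · exact ax (h.adj_of_color_eq hR hx hq k.symm hqx.symm)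
    · exact az (h.adj_of_color_eq hR hz hq k.symm hqz.symm)
  · rcases (h.not_adj_iff q).1 hq with rfl | ⟨i, rfl⟩
    · exact ay hy.symm
    · rcases h3 _ _ _ i hc.1 hc.2.1 hc.2.2 with k | k | k
      · exact ay ((h.adj_iff i y hy).2 k.symm).symm
      · exact ax ((h.adj_iff i x hx).2 k.symm).symm
      · exact az ((h.adj_iff i z hz).2 k.symm).symm

/-- Without a rainbow triangle, each face within the neighbourhood of `v` has exactly one
edge joining vertices of the same colour. -/
theorem card_same_color_adj
    (hno : ∀ S : Finset V, S.card ≤ 3 → ¬ G.IsConnectedDominatingSet (S : Set V)) :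
    (Finset.univ.filter fun d : G.Dart => (G.Adj v d.fst ∧ G.Adj v d.snd ∧ G.Adj v (R.third d)) ∧
      κ d.fst = κ d.snd).card = 4 := by
  let B : G.Dart → Prop := fun d => G.Adj v d.fst ∧ G.Adj v d.snd ∧ G.Adj v (R.third d)
  let P : G.Dart → Prop := fun d => B d ∧ κ d.fst = κ d.snd
  have hB : ∀ d, B (R.facePerm d) ↔ B d := by
    intro d
    simp only [B, R.fst_facePerm, hR.third_facePerm]
    change (_ ∧ G.Adj v (R.third d) ∧ _) ↔ _
    tauto
  have h1 : (Finset.univ.filter fun d => P (R.facePerm d)).card = (Finset.univ.filter P).card :=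
    card_filter_equiv R.facePerm P
  have h2 : (Finset.univ.filter fun d => P (R.facePerm (R.facePerm d))).card =
      (Finset.univ.filter P).card :=
    (card_filter_equiv R.facePerm fun d => P (R.facePerm d)).trans h1
  have h12 : (Finset.univ.filter B).card = 12 := h.card_adj_adj_adj hR
  have hunion : Finset.univ.filter B = Finset.univ.filter P ∪
      ((Finset.univ.filter fun d => P (R.facePerm d)) ∪
        Finset.univ.filter fun d => P (R.facePerm (R.facePerm d))) := by
    ext d
    simp only [Finset.mem_union, Finset.mem_filter, Finset.mem_univ, true_and, P, hB,
      R.fst_facePerm]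
    constructor
    · intro hd
      have e2 : (R.facePerm (R.facePerm d)).snd = d.fst := hR.third_facePerm d
      rw [e2]
      have := h.not_rainbow hR hno hd.1 hd.2.1 hd.2.2 d.adj.symm
        (RotationSystem.adj_snd_third d)
      rcases this with k | k | k
      · exact Or.inl ⟨hd, k⟩
      · exact Or.inr (Or.inl ⟨hd, k.symm⟩)
      · exact Or.inr (Or.inr ⟨hd, k.symm⟩)
    · rintro (hd | hd | hd) <;> exact hd.1
  have hmono : ∀ d, B d → κ d.fst = κ d.snd → κ d.snd = κ (R.third d) → False :=
    fun d hd => h.not_monochromatic hR hd.1 hd.2.1 hd.2.2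
  have hdisj1 : Disjoint (Finset.univ.filter P)
      ((Finset.univ.filter fun d => P (R.facePerm d)) ∪
        Finset.univ.filter fun d => P (R.facePerm (R.facePerm d))) := by
    rw [Finset.disjoint_left]
    intro d hd hd'
    have e2 : (R.facePerm (R.facePerm d)).snd = d.fst := hR.third_facePerm d
    simp only [Finset.mem_union, Finset.mem_filter, Finset.mem_univ, true_and, P, hB,
      R.fst_facePerm, e2] at hd hd'
    rcases hd' with k | k
    · exact hmono d hd.1 hd.2 k.2
    · exact hmono d hd.1 hd.2 (hd.2.symm.trans k.2.symm)
  have hdisj2 : Disjoint (Finset.univ.filter fun d => P (R.facePerm d))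
      (Finset.univ.filter fun d => P (R.facePerm (R.facePerm d))) := by
    rw [Finset.disjoint_left]
    intro d hd hd'
    have e2 : (R.facePerm (R.facePerm d)).snd = d.fst := hR.third_facePerm d
    simp only [Finset.mem_filter, Finset.mem_univ, true_and, P, hB,
      R.fst_facePerm, e2] at hd hd'
    exact hmono d hd.1 (hd'.2.symm.trans hd.2.symm) hd.2
  rw [hunion, Finset.card_union_of_disjoint hdisj1, Finset.card_union_of_disjoint hdisj2, h1, h2]
    at h12
  change (Finset.univ.filter P).card = 4
  omega

/-- The number of colour changes on the cycle of neighbours of `v`. -/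
theorem card_color_changes
    (hno : ∀ S : Finset V, S.card ≤ 3 → ¬ G.IsConnectedDominatingSet (S : Set V)) :
    ((Finset.univ.filter fun d : G.Dart => d.fst = v).filter
      fun d => κ (R.next d).snd ≠ κ d.snd).card = 4 := by
  let Q : G.Dart → Prop := fun d => G.Adj v d.fst ∧ G.Adj v d.snd ∧ κ d.fst = κ d.snd
  have h18 : (Finset.univ.filter Q).card = 18 := h.card_same_color hR
  have h4 := h.card_same_color_adj hR hno
  have h9 := h.card_third_mem hR
  have h9' := h.card_third_eq hR
  have hunion : Finset.univ.filter Q =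
      (Finset.univ.filter fun d : G.Dart => ∃ i, R.third d = u i) ∪
      ((Finset.univ.filter fun d : G.Dart =>
        (G.Adj v d.fst ∧ G.Adj v d.snd ∧ G.Adj v (R.third d)) ∧ κ d.fst = κ d.snd) ∪
      ((Finset.univ.filter fun d : G.Dart => R.third d = v).filter
        fun d => κ d.fst = κ d.snd)) := by
    ext d
    simp only [Finset.mem_union, Finset.mem_filter, Finset.mem_univ, true_and, Q]
    constructor
    · rintro ⟨k1, k2, k3⟩
      by_cases k : G.Adj v (R.third d)
      · exact Or.inr (Or.inl ⟨⟨k1, k2, k⟩, k3⟩)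
      · rcases (h.not_adj_iff _).1 k with k | k
        · exact Or.inr (Or.inr ⟨k, k3⟩)
        · exact Or.inl k
    · have k1 := (hR.adj_fst_third d).symm
      have k2 := (RotationSystem.adj_snd_third (R := R) d).symm
      rintro (⟨i, hi⟩ | ⟨⟨m1, m2, -⟩, m3⟩ | ⟨hi, m3⟩)
      · rw [hi] at k1 k2
        exact ⟨h.adj_of_adj i _ k1, h.adj_of_adj i _ k2,
          (h.eq_color k1).trans (h.eq_color k2).symm⟩
      · exact ⟨m1, m2, m3⟩
      · rw [hi] at k1 k2
        exact ⟨k1, k2, m3⟩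
  rw [hunion, Finset.card_union_of_disjoint, Finset.card_union_of_disjoint, h9, h4] at h18
  -- Here 18 = 9 + 4 + 5, so 5 of the 9 darts opposite to `v` join equal colours and 4 do not. The
  -- permutation `R.facePerm * R.next` takes the darts leaving `v` to those opposite darts.
  · have h5 := Finset.card_filter_add_card_filter_not
      (s := Finset.univ.filter fun d : G.Dart => R.third d = v) (fun d => κ d.fst = κ d.snd)
    have h6 : ((Finset.univ.filter fun d : G.Dart => R.third d = v).filter
        fun d => ¬ κ d.fst = κ d.snd).card = 4 := by omega
    rw [Finset.filter_filter, ← card_filter_equiv (R.facePerm * R.next)] at h6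
    rw [Finset.filter_filter, ← h6]
    congr 1
    ext d
    have e1 : (R.facePerm (R.next d)).snd = d.snd := hR.third_next d
    simp only [Finset.mem_filter, mul_apply, hR.third_facePerm, R.fst_next, R.fst_facePerm, e1,
      ne_eq]
  · rw [Finset.disjoint_left]
    intro d hd hd'
    rw [Finset.mem_filter] at hd hd'
    have := hd'.1
    rw [Finset.mem_filter] at this
    have k := hd.2.1.2.2
    rw [this.2] at k
    exact k.ne rfl
  · rw [Finset.disjoint_left]
    intro d hd hd'
    simp only [Finset.mem_union, Finset.mem_filter, Finset.mem_univ, true_and] at hd hd'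
    obtain ⟨i, hi⟩ := hd
    rcases hd' with hd' | hd'
    · have k := hd'.1.2.2
      rw [hi] at k
      exact h.not_adj i k
    · exact h.ne i (hi.symm.trans hd'.1)

theorem card_fst_eq_color (i : Fin 3) :
    ((Finset.univ.filter fun d : G.Dart => d.fst = v).filter fun d => κ d.snd = i).card = 3 := by
  refine Eq.trans ?_ ((G.card_neighborFinset_eq_degree (u i)).trans (h.degree_eq_three i))
  refine Finset.card_bij (fun d _ => d.snd) ?_ ?_ ?_
  · intro d hd
    simp only [Finset.mem_filter, Finset.mem_univ, true_and] at hd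
    have := d.adj
    rw [hd.1] at this
    exact (G.mem_neighborFinset _ _).2 ((h.adj_iff i _ this).2 hd.2)
  · intro d hd d' hd' hdd'
    simp only [Finset.mem_filter, Finset.mem_univ, true_and] at hd hd'
    exact Dart.ext _ _ (Prod.ext (hd.1.trans hd'.1.symm) hdd')
  · intro x hx
    rw [mem_neighborFinset] at hx
    refine ⟨⟨(v, x), h.adj_of_adj i x hx⟩, ?_, rfl⟩
    simp only [Finset.mem_filter, Finset.mem_univ, true_and]
    exact h.eq_color hx

theorem exists_dominating :
    ∃ S : Finset V, S.card ≤ 3 ∧ G.IsConnectedDominatingSet (S : Set V) := by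
  by_contra! hno
  obtain ⟨e, he, h1, h2, h3⟩ := exists_rainbow_of_four_changes (τ := R.next)
    (X := Finset.univ.filter fun d : G.Dart => d.fst = v) (fun d => by simp [R.fst_next])
    (fun a ha b hb => R.sameCycle a b (by simp at ha hb; rw [ha, hb])) (fun d => κ d.snd)
    (h.card_fst_eq_color hR) (h.card_color_changes hR hno)
  have hev : e.fst = v := by simpa using he
  have hfst : (R.next.symm e).fst = v := by
    rw [← hev, ← R.fst_next (R.next.symm e), apply_symm_apply]
  have a1 : G.Adj v (R.next e).snd := by
    have := (R.next e).adj
    rwa [R.fst_next, hev] at this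
  have a2 : G.Adj v e.snd := by
    have := e.adj
    rwa [hev] at this
  have a3 : G.Adj v (R.next.symm e).snd := by
    have := (R.next.symm e).adj
    rwa [hfst] at this
  have hstep : ∀ d : G.Dart, G.Adj d.snd (R.next d).snd := by
    intro d
    have := hR.adj_fst_third d.symm
    rwa [RotationSystem.third_symm] at this
  have b2 := (hstep (R.next.symm e)).symm
  rw [apply_symm_apply] at b2
  rcases h.not_rainbow hR hno a1 a2 a3 (hstep e) b2 with k | k | k
  · exact h1 k
  · exact h2 k
  · exact h3 k

end IsThreeCapped

theorem IsTriangulation.exists_dominating (hG : G.IsTriangulation) (hn : Fintype.card V ≤ 13)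
    {v : V} (hv : G.degree v + 4 = Fintype.card V) :
    ∃ S : Finset V, S.card ≤ 3 ∧ G.IsConnectedDominatingSet (S : Set V) := by
  by_contra! hno
  have hcard : 4 ≤ Nat.card V := by rw [Nat.card_eq_fintype_card]; omega
  obtain ⟨R, hR, hdart⟩ := hG.exists_isTriangular hcard
  have : Nonempty V := ⟨v⟩
  have : Nontrivial V := Fintype.one_lt_card_iff_nontrivial.1 (by omega)
  have hpos : ∀ x, ∃ y, G.Adj x y := fun x => hG.connected.preconnected.exists_adj_of_nontrivial x
  have hN : (Finset.univ.filter fun x => ¬ G.Adj v x ∧ x ≠ v).card = 3 := by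
    have h1 : (Finset.univ.filter fun x => ¬ G.Adj v x ∧ x ≠ v) =
        (insert v (G.neighborFinset v))ᶜ := by
      ext x
      simp only [Finset.mem_filter, Finset.mem_univ, true_and, Finset.mem_compl,
        Finset.mem_insert, mem_neighborFinset]
      tauto
    rw [h1, Finset.card_compl, Finset.card_insert_of_notMem (by simp),
      card_neighborFinset_eq_degree]
    omega
  let E := (Finset.equivFinOfCardEq hN).symm
  let u : Fin 3 → V := fun i => (E i).1
  have hu : Function.Injective u := Subtype.val_injective.comp E.injective
  have humem : ∀ i, ¬ G.Adj v (u i) ∧ u i ≠ v := fun i =>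
    (Finset.mem_filter.1 (E i).2).2
  have huv : ∀ i, u i ≠ v := fun i => (humem i).2
  have hvu : ∀ x, ¬ G.Adj v x ↔ x = v ∨ ∃ i, x = u i := by
    intro x
    constructor
    · intro hx
      by_cases hxv : x = v
      · exact Or.inl hxv
      · refine Or.inr ⟨E.symm ⟨x, by simp [hx, hxv]⟩, ?_⟩
        simp [u]
    · rintro (rfl | ⟨i, rfl⟩)
      · exact fun h => h.ne rfl
      · exact (humem i).1
  obtain ⟨hadj, huniq⟩ := hR.neighbors_of_no_dominating
    (fun S hS => hno S hS) hpos hvu huv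
  have hdeg : ∀ i, 3 ≤ G.degree (u i) := by
    intro i
    obtain ⟨y, hy⟩ := hpos (u i)
    exact hR.three_le_degree ⟨(u i, y), hy⟩
  obtain ⟨h9, h3, hcov⟩ := degree_eq_of_disjoint_neighbors hadj huniq hdeg (by omega)
  have hκ : ∀ x, ∃ i, G.Adj v x → G.Adj (u i) x := by
    intro x
    by_cases hx : G.Adj v x
    · obtain ⟨i, hi⟩ := hcov x hx
      exact ⟨i, fun _ => hi⟩
    -- Colours outside N(v) are irrelevant; 0 is a default.
    · exact ⟨0, fun h => absurd h hx⟩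
  choose κ hκ using hκ
  have hcap : IsThreeCapped G v u κ :=
    { injective := hu
      not_adj_iff := hvu
      ne := huv
      adj_of_adj := hadj
      adj_iff := fun i x hx =>
        ⟨fun h => huniq x _ _ (hκ x hx) h, fun h => h ▸ hκ x hx⟩
      degree_eq_nine := h9
      degree_eq_three := h3
      card_dart := by
        rw [Nat.card_eq_fintype_card, Nat.card_eq_fintype_card] at hdart
        omega }
  obtain ⟨S, hS, hS'⟩ := hcap.exists_dominating hR
  exact hno S hS hS'

end SimpleGraph

theorem lemma2p4 {V : Type*} [Fintype V] (G : SimpleGraph V) [DecidableRel G.Adj]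
    (hG : G.IsTriangulation) (hn : Fintype.card V ≤ 13)
    (hΔ : (G.maxDegree : ℤ) = (Fintype.card V : ℤ) - 4) :
    G.connectedDominationNumber = 2 ∨ G.connectedDominationNumber = 3 := by
  classical
  -- The degree equation over ℤ forces at least four vertices.
  have : Nonempty V := Fintype.card_pos_iff.1 (by omega)
  obtain ⟨v, hv⟩ := G.exists_maximal_degree_vertex
  obtain ⟨S, hS, hS'⟩ := hG.exists_dominating hn (v := v) (by omega)
  have hne : {k : ℕ | ∃ S : Finset V, G.IsConnectedDominatingSet (S : Set V) ∧
      S.card = k}.Nonempty := ⟨_, S, hS', rfl⟩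
  obtain ⟨T, hT, hTcard⟩ := Nat.sInf_mem hne
  have h2 := SimpleGraph.two_le_card_of_isConnectedDominatingSet hT (by omega)
  have h3 : sInf {k : ℕ | ∃ S : Finset V, G.IsConnectedDominatingSet (S : Set V) ∧
      S.card = k} ≤ S.card := Nat.sInf_le ⟨S, hS', rfl⟩
  rw [hTcard] at h2
  rw [SimpleGraph.connectedDominationNumber]
  omega
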